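/- **Worst-case quantum easiness of Total Bipartite NullCodeword (TBNC).** *Parameters and code.* For an integer $s\ge 1$ let $n=2^s-1$, $q=2^{2s}$, $N=q-1$, $m=2^s+1=N/n$, and $\Sigma=\mathbb F_q^m$. Let $\gamma$ be any generator of $\mathbb F_q^*$ and $a\in\{0,1\}\subset\mathbb F_q$. Let $C_n\subseteq\Sigma^n$ be the $m$-folded Reed–Solomon code, consisting of the words $(f(a),f(\gamma),f(\gamma^2),\dots,f(\gamma^{N-1}))$, cut into $n$ consecutive blocks of length $m$, where $f$ ranges over the polynomials over $\mathbb F_q$ of degree at most $\lfloor N/10\rfloor$. *Hash family.* Let $\ell=2sm+s$. Fix any injection $\mathrm{enc}:\Sigma\times[n]\hookrightarrow\mathbb F_{2^\ell}$ and any bijection $\mathrm{bits}:\mathbb F_{2^\ell}\to\{0,1\}^\ell$. The keys are the vectors $k=(k_0,\dots,k_{n^2-1})\in\mathcal K=\mathbb F_{2^\ell}^{\,n^2}$, so $|\mathcal K|=2^r$ with $r=n^2\ell$, and $\tilde h_k(e,j)\in\{0,1\}^6$ consists of the first six bits of $\mathrm{bits}\bigl(\sum_{i<n^2}k_i\,\mathrm{enc}(e,j)^i\bigr)$.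 (This is the standard $n^2$-wise independent family given by polynomials of degree less than $n^2$.) *The problem.* Let $t=nr$. The input consists of functions $\tilde H^{(i)}_j:\Sigma\to\{0,1\}^6$ for $i\in[t]$, $j\in[n]$; Alice holds those with $j\le\lfloor n/2\rfloor$ and Bob holds the others. A valid output is a key $k\in\mathcal K$ and words $x^{(1)},\dots,x^{(t)}$ such that for every $i\in[t]$ we have $x^{(i)}\in C_n$, and for every $j\in[n]$ the AND of the six bits of $\tilde H^{(i)}_j(x^{(i)}_j)\oplus\tilde h_k(x^{(i)}_j,j)$ equals $0$. *The model.* In a quantum SMP protocol (without shared randomness or entanglement) Alice and Bob each send a pure state that depends only on their own input to a referee, who applies a measurement that does not depend on the inputs to the product of the two states and outputs the outcome. The cost is the total number of qubits sent. *Claim.* There are a polynomial $P$ and a negligible function $\varepsilon$ (that is, $n^d\varepsilon(n)\to0$ for every $d$) such that for every $s\ge1$ and all choices of $\gamma$, $a$, $\mathrm{enc}$, $\mathrm{bits}$ there is a quantum SMP protocol of cost at most $P(n)$ that, on every (worst-case) input, outputs a valid solution of TBNC with probability at least $1-\varepsilon(n)$. -/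

import Mathlib

open scoped Polynomial ComplexOrder
open Filter

/-! ### Quantum simultaneous-message protocols -/

/-- A quantum simultaneous message passing protocol without shared randomness or entanglement.
On input `x` Alice sends a pure state of `aliceQubits` qubits, on input `y` Bob sends a pure state
of `bobQubits` qubits, and the referee Charlie, who holds no input, applies a fixed measurement
(a POVM with outcomes in `O`) to the product state and outputs the outcome. -/
structure QSMPProtocol (X Y O : Type) [Fintype O] where
  aliceQubits : ℕ
  bobQubits : ℕ
  alice : X → EuclideanSpace ℂ (Fin aliceQubits → Bool)
  bob : Y → EuclideanSpace ℂ (Fin bobQubits → Bool)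
  norm_alice : ∀ x, ‖alice x‖ = 1
  norm_bob : ∀ y, ‖bob y‖ = 1
  measurement : O → Matrix ((Fin aliceQubits → Bool) × (Fin bobQubits → Bool))
    ((Fin aliceQubits → Bool) × (Fin bobQubits → Bool)) ℂ
  posSemidef_measurement : ∀ o, (measurement o).PosSemidef
  sum_measurement : ∑ o, measurement o = 1

namespace QSMPProtocol

variable {X Y O : Type} [Fintype O]

/-- The number of qubits sent by Alice and Bob together. -/
def cost (P : QSMPProtocol X Y O) : ℕ := P.aliceQubits + P.bobQubits

/-- The amplitudes of the product of the states of Alice and Bob. -/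
def jointState (P : QSMPProtocol X Y O) (x : X) (y : Y) :
    (Fin P.aliceQubits → Bool) × (Fin P.bobQubits → Bool) → ℂ :=
  fun u => P.alice x u.1 * P.bob y u.2

/-- The probability that Charlie outputs `o` on input `(x, y)` (the Born rule). -/
noncomputable def outputProb (P : QSMPProtocol X Y O) (x : X) (y : Y) (o : O) : ℝ :=
  (star (P.jointState x y) ⬝ᵥ ((P.measurement o).mulVec (P.jointState x y))).re

open Classical in
/-- The probability that the output is correct for the two-party search problem `R`. -/
noncomputable def successProb (P : QSMPProtocol X Y O) (R : X → Y → O → Prop) (x : X) (y : Y) : ℝ :=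
  ∑ o : O, if R x y o then P.outputProb x y o else 0

end QSMPProtocol

/-! ### Folded Reed--Solomon codes -/

/-- The Reed--Solomon code of length `N` and degree `k` with evaluation points
`a, γ, γ ^ 2, …, γ ^ (N - 1)`; for `a = 1` these are the powers of `γ`. -/
def reedSolomon {F : Type} [Field F] (a γ : F) (N k : ℕ) : Set (Fin N → F) :=
  {c | ∃ f : F[X], f.natDegree ≤ k ∧
    ∀ i : Fin N, c i = f.eval (if (i : ℕ) = 0 then a else γ ^ (i : ℕ))}

/-- The `m`-folded code: consecutive blocks of `m` coordinates become one symbol. The bijection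
`finProdFinEquiv` sends `(j, l)` to `m * j + l`. -/
def foldedCode {F : Type} {n m : ℕ} (C : Set (Fin (n * m) → F)) : Set (Fin n → Fin m → F) :=
  {c | (fun i => c (finProdFinEquiv.symm i).1 (finProdFinEquiv.symm i).2) ∈ C}

/-! ### The parameters, as functions of an exponent `s ≥ 1` -/

/-- The block length `n = 2 ^ s - 1`. -/
def codeLength (s : ℕ) : ℕ := 2 ^ s - 1

/-- The folding parameter `m = 2 ^ s + 1`, so that `n * m = q - 1` for `q = 2 ^ (2 * s)`. -/
def foldSize (s : ℕ) : ℕ := 2 ^ s + 1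

/-- The field with `q = 2 ^ (2 * s)` elements. -/
abbrev CodeField (s : ℕ) : Type := GaloisField 2 (2 * s)

/-- The alphabet `Σ`, the `m`-th power of the field with `q` elements. -/
abbrev Alphabet (s : ℕ) : Type := Fin (foldSize s) → CodeField s

/-- The code: the `m`-folded Reed--Solomon code of unfolded length `N = n * m = q - 1` and degree
`⌊0.1 * N⌋`. -/
def nullCode (s : ℕ) (a γ : CodeField s) : Set (Fin (codeLength s) → Alphabet s) :=
  foldedCode (reedSolomon a γ (codeLength s * foldSize s) (codeLength s * foldSize s / 10))

/-! ### The hash family -/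

/-- The bit length of the field underlying the hash family: an element of `Σ × [n]` is encoded by
`2 * s * m + s` bits, and the hash values have six bits. -/
def hashBits (s : ℕ) : ℕ := max (2 * s * foldSize s + s) 6

/-- The field with `2 ^ hashBits s` elements. -/
abbrev HashField (s : ℕ) : Type := GaloisField 2 (hashBits s)

/-- A key consists of the `n ^ 2` coefficients of a polynomial of degree less than `n ^ 2`. -/
abbrev HashKey (s : ℕ) : Type := Fin (codeLength s ^ 2) → HashField s

/-- The key length `r`: there are `2 ^ r` keys. -/
def keyLength (s : ℕ) : ℕ := codeLength s ^ 2 * hashBits s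

/-- The standard `n ^ 2`-wise independent family of functions from `Σ × [n]` to six-bit strings:
encode the argument as a field element, evaluate the polynomial given by the key, and keep the
first six bits of the result. -/
noncomputable def polyHash {s : ℕ} (enc : Alphabet s × Fin (codeLength s) ↪ HashField s)
    (bits : HashField s ≃ (Fin (hashBits s) → Bool)) (k : HashKey s)
    (e : Alphabet s) (j : Fin (codeLength s)) : Fin 6 → Bool :=
  fun b => bits (∑ i, k i * enc (e, j) ^ (i : ℕ)) (Fin.castLE (le_max_right _ _) b)

/-! ### Total Bipartite NullCodeword -/

/-- The number of instances `t = n * r`. -/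
def numInstances (s : ℕ) : ℕ := codeLength s * keyLength s

/-- The coordinates of Alice, the first `⌊n / 2⌋`. -/
abbrev AliceIdx (n : ℕ) : Type := {j : Fin n // (j : ℕ) < n / 2}

/-- The coordinates of Bob, all the others. -/
abbrev BobIdx (n : ℕ) : Type := {j : Fin n // ¬ (j : ℕ) < n / 2}

/-- Alice holds, for each instance and each of her coordinates, a function from `Σ` to six-bit
strings. -/
abbrev AliceInput (s : ℕ) : Type :=
  Fin (numInstances s) → AliceIdx (codeLength s) → Alphabet s → Fin 6 → Bool

/-- The same for Bob. -/
abbrev BobInput (s : ℕ) : Type :=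
  Fin (numInstances s) → BobIdx (codeLength s) → Alphabet s → Fin 6 → Bool

/-- An output is a key together with one word for each instance. -/
abbrev TBNCOutput (s : ℕ) : Type :=
  HashKey s × (Fin (numInstances s) → Fin (codeLength s) → Alphabet s)

noncomputable instance (s : ℕ) : Fintype (TBNCOutput s) := Fintype.ofFinite _

/-- The conjunction of the six bits of the bitwise exclusive or of `u` and `v`. For uniformly
random `u` it equals `true` with probability `2 ^ (-6)`. -/
def andXor (u v : Fin 6 → Bool) : Bool := decide (∀ b, xor (u b) (v b) = true)

/-- The relation: every word is a codeword that is null for its instance after hashing. -/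
def TBNC {s : ℕ} (a γ : CodeField s) (enc : Alphabet s × Fin (codeLength s) ↪ HashField s)
    (bits : HashField s ≃ (Fin (hashBits s) → Bool))
    (HA : AliceInput s) (HB : BobInput s) (o : TBNCOutput s) : Prop :=
  ∀ i : Fin (numInstances s),
    o.2 i ∈ nullCode s a γ ∧
    (∀ j : AliceIdx (codeLength s),
      andXor (HA i j (o.2 i j)) (polyHash enc bits o.1 (o.2 i j) j) = false) ∧
    (∀ j : BobIdx (codeLength s),
      andXor (HB i j (o.2 i j)) (polyHash enc bits o.1 (o.2 i j) j) = false)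

/-! ### Isometries -/

section Isometry

open Matrix

/-! The proof is the Yamakawa–Zhandry argument, carried out inside a single measurement. For every
instance and coordinate, the player who holds the function H sends n copies of the uniform
superposition of the pairs (x, H(x)). These are product states, so the cut between Alice and Bob is
harmless. Charlie draws the key k at random. On one copy, the coisometry `acceptMatrix` keeps the
symbols that pass the test against k and erases the hash value. It succeeds with probability about
1/64, so some copy succeeds except with exponentially small probability
(`exists_isometry_first_success`). The n coordinates of an instance then carry amplitudes
proportional to F(x) = ∏ f_j(x_j), the indicator of the words that are null after hashing.

It remains to restrict F to the code C. After a Fourier transform, every character of weight at most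
n/20 is sent to its restriction to C. Two such characters differ in at most n/10 blocks, on which C
interpolates, so their restrictions are orthogonal and the map extends to an isometry
(`isometry_decodeMatrix`). If F had no heavier characters, Fourier inversion would turn the result
into a multiple of F on C; in general the loss is controlled by the heavy part of F
(`le_sum_decode`). Only qubits are counted, so no efficient decoder is needed.

The heavy part is small on average over k, whatever the input. Only second moments of F enter; they
involve at most 2n hash values, so limited independence gives the same moments as truly random
functions. The Fourier coefficients are then uncorrelated with product variances
(`sum_fourier_mul_star`), and a Chernoff bound controls the tail (`sum_spectralWeight_tail_le`).
This is how a freely chosen key turns a worst-case input into an average one. A union bound handles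
the instances, which share the key. -/

theorem ofReal_sum_norm_sq {V : Type} [Fintype V] (v : V → ℂ) :
    ((∑ u, ‖v u‖ ^ 2 : ℝ) : ℂ) = star v ⬝ᵥ v := by
  simp [dotProduct, Complex.conj_mul']

theorem isometry_iff {Ω V : Type} [Fintype Ω] [DecidableEq V] (J : Matrix Ω V ℂ) :
    Jᴴ * J = 1 ↔ ∀ u v, ∑ ω, star (J ω u) * J ω v = if u = v then 1 else 0 := by
  rw [← Matrix.ext_iff]
  simp [Matrix.mul_apply, Matrix.one_apply]

theorem sum_norm_sq_mulVec {Ω V : Type} [Fintype Ω] [Fintype V] [DecidableEq V]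
    {J : Matrix Ω V ℂ} (hJ : Jᴴ * J = 1) (v : V → ℂ) :
    ∑ ω, ‖(J *ᵥ v) ω‖ ^ 2 = ∑ u, ‖v u‖ ^ 2 := by
  apply Complex.ofReal_injective
  rw [ofReal_sum_norm_sq, ofReal_sum_norm_sq, star_mulVec, ← dotProduct_mulVec, mulVec_mulVec, hJ,
    one_mulVec]

theorem isometry_mul {Ω Ω' V : Type} [Fintype Ω] [Fintype Ω'] [Fintype V] [DecidableEq V]
    [DecidableEq Ω'] {J : Matrix Ω Ω' ℂ} {K : Matrix Ω' V ℂ} (hJ : Jᴴ * J = 1) (hK : Kᴴ * K = 1) :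
    (J * K)ᴴ * (J * K) = 1 := by
  rw [conjTranspose_mul, Matrix.mul_assoc, ← Matrix.mul_assoc Jᴴ, hJ, Matrix.one_mul, hK]

theorem isometry_submatrix_equiv {Ω V V' : Type} [Fintype Ω] [DecidableEq V] [DecidableEq V']
    {J : Matrix Ω V ℂ} (hJ : Jᴴ * J = 1) (e : V' ≃ V) :
    (J.submatrix id e)ᴴ * J.submatrix id e = 1 := by
  rw [isometry_iff] at hJ ⊢
  intro u v
  simpa using hJ (e u) (e v)

/-- The tensor product of a family of matrices. -/
def piMatrix {ι : Type} [Fintype ι] {V : ι → Type} {Ω : ι → Type}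
    (J : ∀ i, Matrix (Ω i) (V i) ℂ) : Matrix (∀ i, Ω i) (∀ i, V i) ℂ :=
  fun ω u => ∏ i, J i (ω i) (u i)

theorem sum_prod_pi {R ι : Type} [CommSemiring R] [Fintype ι] [DecidableEq ι] {V : ι → Type}
    [∀ i, Fintype (V i)] (g : ∀ i, V i → R) :
    ∑ u : ∀ i, V i, ∏ i, g i (u i) = ∏ i, ∑ v, g i v :=
  (Fintype.prod_sum g).symm

theorem isometry_piMatrix {ι : Type} [Fintype ι] [DecidableEq ι] {V : ι → Type} {Ω : ι → Type}
    [∀ i, DecidableEq (V i)] [∀ i, Fintype (Ω i)] {J : ∀ i, Matrix (Ω i) (V i) ℂ}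
    (hJ : ∀ i, (J i)ᴴ * J i = 1) : (piMatrix J)ᴴ * piMatrix J = 1 := by
  rw [isometry_iff]
  intro u v
  have h : ∀ ω : ∀ i, Ω i, star (piMatrix J ω u) * piMatrix J ω v =
      ∏ i, star (J i (ω i) (u i)) * J i (ω i) (v i) := fun ω => by
    simp [piMatrix, Finset.prod_mul_distrib]
  simp_rw [h]
  rw [sum_prod_pi (fun i (x : Ω i) => star (J i x (u i)) * J i x (v i))]
  simp_rw [fun i => (isometry_iff (J i)).1 (hJ i) (u i) (v i)]
  by_cases huv : u = v
  · simp [huv]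
  · obtain ⟨i, hi⟩ := Function.ne_iff.1 huv
    rw [if_neg huv]
    exact Finset.prod_eq_zero (Finset.mem_univ i) (if_neg hi)

theorem piMatrix_mulVec {ι : Type} [Fintype ι] [DecidableEq ι] {V : ι → Type} {Ω : ι → Type}
    [∀ i, Fintype (V i)] (J : ∀ i, Matrix (Ω i) (V i) ℂ) (v : ∀ i, V i → ℂ) (ω : ∀ i, Ω i) :
    (piMatrix J *ᵥ fun u => ∏ i, v i (u i)) ω = ∏ i, (J i *ᵥ v i) (ω i) := by
  simp only [mulVec, dotProduct, piMatrix, ← Finset.prod_mul_distrib]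
  exact sum_prod_pi (fun i x => J i (ω i) x * v i x)

/-! ### Protocols from isometries -/

open Classical in
/-- The rows of `J` that lead to the outcome `o`, with the columns relabelled. -/
noncomputable def outcomeMatrix {Ω O V V' : Type} (J : Matrix Ω V ℂ) (out : Ω → O) (e : V' ≃ V)
    (o : O) : Matrix Ω V' ℂ :=
  Matrix.of fun ω u => if out ω = o then J ω (e u) else 0

open Classical in
theorem sum_outcomeMatrix {Ω O V V' : Type} [Fintype Ω] [Fintype O] [DecidableEq V']
    [DecidableEq V] {J : Matrix Ω V ℂ} (hJ : Jᴴ * J = 1) (out : Ω → O) (e : V' ≃ V) :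
    ∑ o, (outcomeMatrix J out e o)ᴴ * outcomeMatrix J out e o = 1 := by
  rw [← isometry_submatrix_equiv hJ e]
  ext u v
  rw [Matrix.sum_apply]
  simp only [mul_apply, conjTranspose_apply, outcomeMatrix, of_apply, submatrix_apply, id]
  rw [Finset.sum_comm]
  refine Finset.sum_congr rfl fun ω _ => ?_
  rw [Finset.sum_eq_single (out ω)]
  · simp
  · intro o _ ho
    simp [Ne.symm ho]
  · simp

open Classical in
theorem outcomeMatrix_mulVec {Ω O V V' : Type} [Fintype V] [Fintype V']
    (J : Matrix Ω V ℂ) (out : Ω → O) (e : V' ≃ V) (o : O) (v : V → ℂ) (ω : Ω) :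
    (outcomeMatrix J out e o *ᵥ fun u => v (e u)) ω = if out ω = o then (J *ᵥ v) ω else 0 := by
  simp only [mulVec, dotProduct, outcomeMatrix, of_apply]
  split_ifs
  · exact Equiv.sum_comp e (fun u => J ω u * v u)
  · simp

theorem re_dotProduct_conjTranspose_mul_self {Ω V : Type} [Fintype Ω] [Fintype V]
    (M : Matrix Ω V ℂ) (v : V → ℂ) :
    (star v ⬝ᵥ ((Mᴴ * M) *ᵥ v)).re = ∑ ω, ‖(M *ᵥ v) ω‖ ^ 2 := by
  rw [← mulVec_mulVec, dotProduct_mulVec, ← star_mulVec, ← ofReal_sum_norm_sq, Complex.ofReal_re]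

open Classical in
/-- Charlie may apply an isometry, measure in the standard basis and postprocess the outcome. -/
theorem exists_protocol_of_isometry {X Y O Ω VA VB : Type} [Fintype O] [Fintype Ω] [Fintype VA]
    [Fintype VB] [DecidableEq VA] [DecidableEq VB] (qa qb : ℕ) (eA : (Fin qa → Bool) ≃ VA)
    (eB : (Fin qb → Bool) ≃ VB)
    (alice : X → VA → ℂ) (bob : Y → VB → ℂ) (hA : ∀ x, ∑ u, ‖alice x u‖ ^ 2 = 1)
    (hB : ∀ y, ∑ u, ‖bob y u‖ ^ 2 = 1) (J : Matrix Ω (VA × VB) ℂ) (hJ : Jᴴ * J = 1)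
    (out : Ω → O) :
    ∃ Q : QSMPProtocol X Y O, Q.cost = qa + qb ∧ ∀ (R : X → Y → O → Prop) x y,
      Q.successProb R x y = ∑ ω, if R x y (out ω) then
        ‖(J *ᵥ fun u => alice x u.1 * bob y u.2) ω‖ ^ 2 else 0 := by
  refine ⟨{ aliceQubits := qa
            bobQubits := qb
            alice := fun x => WithLp.toLp 2 fun u => alice x (eA u)
            bob := fun y => WithLp.toLp 2 fun u => bob y (eB u)
            norm_alice := fun x => ?_
            norm_bob := fun y => ?_
            measurement := fun o => (outcomeMatrix J out (eA.prodCongr eB) o)ᴴ *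
              outcomeMatrix J out (eA.prodCongr eB) o
            posSemidef_measurement := fun o => posSemidef_conjTranspose_mul_self _
            sum_measurement := ?_ }, rfl, ?_⟩
  · rw [EuclideanSpace.norm_eq, Real.sqrt_eq_one, ← hA x]
    exact Equiv.sum_comp eA (fun u => ‖alice x u‖ ^ 2)
  · rw [EuclideanSpace.norm_eq, Real.sqrt_eq_one, ← hB y]
    exact Equiv.sum_comp eB (fun u => ‖bob y u‖ ^ 2)
  · convert sum_outcomeMatrix hJ out (eA.prodCongr eB)
  · intro R x y
    simp only [QSMPProtocol.successProb, QSMPProtocol.outputProb,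
      re_dotProduct_conjTranspose_mul_self]
    have h : ∀ o ω, (outcomeMatrix J out (eA.prodCongr eB) o *ᵥ
        fun u => alice x (eA u.1) * bob y (eB u.2)) ω =
        if out ω = o then (J *ᵥ fun u => alice x u.1 * bob y u.2) ω else 0 := fun o ω =>
      outcomeMatrix_mulVec J out (eA.prodCongr eB) o (fun u => alice x u.1 * bob y u.2) ω
    calc _ = ∑ o, ∑ ω, if R x y o then (if out ω = o then
          ‖(J *ᵥ fun u => alice x u.1 * bob y u.2) ω‖ ^ 2 else 0) else 0 := by
          refine Finset.sum_congr rfl fun o _ => ?_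
          split_ifs
          · refine Finset.sum_congr rfl fun ω _ => ?_
            have := h o ω
            refine Eq.trans (congrArg (fun z : ℂ => ‖z‖ ^ 2) this) ?_
            split_ifs <;> simp
          · simp
      _ = _ := by
          rw [Finset.sum_comm]
          refine Finset.sum_congr rfl fun ω _ => ?_
          rw [Finset.sum_eq_single (out ω)]
          · simp
          · intro o _ ho
            simp [Ne.symm ho]
          · simp

/-! ### Repetition -/

/-- Apply the coisometry `A` to several copies of a state until it succeeds for the first time. -/
theorem exists_isometry_first_success {B W : Type} [Fintype B] [DecidableEq B] [Fintype W]
    [DecidableEq W] [Nonempty W] (A : Matrix W B ℂ) (hA : A * Aᴴ = 1) (T : ℕ) :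
    ∃ (G : Type) (_ : Fintype G) (good : G → Bool)
      (J : Matrix (G × W) (Fin T → B) ℂ), Jᴴ * J = 1 ∧ ∀ ψ : B → ℂ, ∑ b, ‖ψ b‖ ^ 2 = 1 →
      ∃ c : G → ℂ, (∀ g, good g → ∀ w, (J *ᵥ fun u => ∏ t, ψ (u t)) (g, w) = c g * (A *ᵥ ψ) w) ∧
        (∑ g, if good g then ‖c g‖ ^ 2 else 0) * ∑ w, ‖(A *ᵥ ψ) w‖ ^ 2 =
          1 - (1 - ∑ w, ‖(A *ᵥ ψ) w‖ ^ 2) ^ T := by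
  classical
  induction T with
  | zero =>
    obtain ⟨w₀⟩ := ‹Nonempty W›
    refine ⟨Unit, inferInstance, fun _ => false,
      Matrix.of fun p _ => if p.2 = w₀ then 1 else 0, ?_, fun ψ _ => ⟨0, by simp, by simp⟩⟩
    rw [isometry_iff]
    intro u v
    rw [Fintype.sum_prod_type]
    simp [Subsingleton.elim u v]
  | succ T ih =>
    obtain ⟨G, _, good, J, hJ, hψ⟩ := ih
    -- Since `A` is a coisometry, `Aᴴ * A` is a projection; `S` is the complementary projection,
    -- onto the failure subspace.
    set S : Matrix B B ℂ := 1 - Aᴴ * A with hS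
    have hSS : Sᴴ * S + Aᴴ * A = 1 := by
      have h1 : Sᴴ = S := by simp [hS]
      have h2 : Aᴴ * A * (Aᴴ * A) = Aᴴ * A := by
        rw [Matrix.mul_assoc, ← Matrix.mul_assoc A, hA, Matrix.one_mul]
      rw [h1, hS, Matrix.sub_mul, Matrix.one_mul, Matrix.mul_sub, Matrix.mul_one, h2]
      simp
    -- On success at the first copy the untouched copies are kept as garbage. On failure the
    -- residual state of the first copy is kept and the remaining `T` copies are treated
    -- recursively.
    let J' : Matrix (((Fin T → B) ⊕ (B × G)) × W) (Fin (T + 1) → B) ℂ := Matrix.of fun p u =>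
      Sum.elim (fun r => if r = Fin.tail u then A p.2 (u 0) else 0)
        (fun q => S q.1 (u 0) * J (q.2, p.2) (Fin.tail u)) p.1
    refine ⟨(Fin T → B) ⊕ (B × G), inferInstance, Sum.elim (fun _ => true) (fun q => good q.2),
      J', ?_, fun ψ hn => ?_⟩
    · rw [isometry_iff] at hJ ⊢
      intro u v
      have e1 : ∀ x y, ∑ b, star (S b x) * S b y + ∑ w, star (A w x) * A w y =
          if x = y then 1 else 0 := fun x y => by
        have := congrFun (congrFun hSS x) y
        simpa [Matrix.mul_apply, Matrix.one_apply] using this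
      rw [Fintype.sum_prod_type, Fintype.sum_sum_type]
      have l1 : ∑ r : Fin T → B, ∑ w, star (J' (Sum.inl r, w) u) * J' (Sum.inl r, w) v =
          (if Fin.tail u = Fin.tail v then 1 else 0) * ∑ w, star (A w (u 0)) * A w (v 0) := by
        rw [Finset.sum_eq_single (Fin.tail u)]
        · simp only [J', of_apply, Sum.elim_inl, if_true]
          split_ifs <;> simp
        · intro r _ hr
          simp [J', hr]
        · simp
      have l2 : ∑ q : B × G, ∑ w, star (J' (Sum.inr q, w) u) * J' (Sum.inr q, w) v =
          (if Fin.tail u = Fin.tail v then 1 else 0) * ∑ b, star (S b (u 0)) * S b (v 0) := by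
        rw [← hJ, Fintype.sum_prod_type, mul_comm, Finset.sum_mul]
        refine Finset.sum_congr rfl fun b _ => ?_
        rw [Fintype.sum_prod_type, Finset.mul_sum]
        refine Finset.sum_congr rfl fun g _ => ?_
        rw [Finset.mul_sum]
        refine Finset.sum_congr rfl fun w _ => ?_
        simp only [J', of_apply, Sum.elim_inr, star_mul']
        ring
      rw [l1, l2, ← mul_add, add_comm (∑ w, _), e1]
      have huv : u = v ↔ Fin.tail u = Fin.tail v ∧ u 0 = v 0 := by
        constructor
        · rintro rfl
          simp
        · rintro ⟨h, h0⟩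
          rw [← Fin.cons_self_tail u, ← Fin.cons_self_tail v, h, h0]
      by_cases a : Fin.tail u = Fin.tail v <;> by_cases b : u 0 = v 0 <;> simp [huv, a, b]
    · obtain ⟨c, hc, hp⟩ := hψ ψ hn
      -- The garbage contributes only a scalar: the amplitude of the unused copies after a success,
      -- or the residual of the failed copy times the scalar from the recursion.
      refine ⟨Sum.elim (fun r => ∏ t, ψ (r t)) (fun q => (S *ᵥ ψ) q.1 * c q.2), ?_, ?_⟩
      · have hsplit : ∀ f : (Fin (T + 1) → B) → ℂ, ∑ u, f u = ∑ x, ∑ r, f (Fin.cons x r) := by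
          intro f
          rw [← (Fin.consEquiv fun _ => B).sum_comp, Fintype.sum_prod_type]
          rfl
        rintro (r | q) hg w
        · simp only [mulVec, dotProduct, J', of_apply, Sum.elim_inl, hsplit, Fin.tail_cons,
            Fin.cons_zero, Fin.prod_univ_succ, Fin.cons_succ]
          simp only [ite_mul, zero_mul, Finset.sum_ite_eq, Finset.mem_univ, if_true, Finset.mul_sum]
          refine Finset.sum_congr rfl fun x _ => ?_
          ring
        · have := hc q.2 hg w
          simp only [Sum.elim_inr]
          rw [mul_assoc, ← this]
          simp only [mulVec, dotProduct, J', of_apply, Sum.elim_inr, hsplit, Fin.tail_cons,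
            Fin.cons_zero, Fin.prod_univ_succ, Fin.cons_succ]
          rw [Finset.sum_mul_sum]
          refine Finset.sum_congr rfl fun x _ => Finset.sum_congr rfl fun r _ => ?_
          ring
      · have hS1 : ∑ b, ‖(S *ᵥ ψ) b‖ ^ 2 = 1 - ∑ w, ‖(A *ᵥ ψ) w‖ ^ 2 := by
          rw [eq_sub_iff_add_eq, ← re_dotProduct_conjTranspose_mul_self,
            ← re_dotProduct_conjTranspose_mul_self, ← Complex.add_re, ← dotProduct_add,
            ← add_mulVec, hSS, one_mulVec, ← ofReal_sum_norm_sq, hn]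
          simp
        have hP : ∑ r : Fin T → B, ‖∏ t, ψ (r t)‖ ^ 2 = 1 := by
          simp only [norm_prod, ← Finset.prod_pow]
          rw [sum_prod_pi (fun (_ : Fin T) b => ‖ψ b‖ ^ 2)]
          simp [hn]
        have : ∑ b, ∑ g, (if good g then ‖(S *ᵥ ψ) b * c g‖ ^ 2 else 0) =
            (1 - ∑ w, ‖(A *ᵥ ψ) w‖ ^ 2) * ∑ g, if good g then ‖c g‖ ^ 2 else 0 := by
          rw [← hS1, Finset.sum_mul_sum]
          refine Finset.sum_congr rfl fun b _ => Finset.sum_congr rfl fun g _ => ?_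
          split_ifs <;> simp [mul_pow]
        rw [Fintype.sum_sum_type, Fintype.sum_prod_type]
        refine (congrArg (· * _) (congrArg₂ (· + ·) hP this)).trans ?_
        rw [add_mul, mul_assoc, hp]
        ring

end Isometry

/-! ### Fourier analysis on a finite product group -/

section Fourier

set_option linter.unusedSectionVars false

open Matrix

theorem sqrt_card_mul_self {A : Type} [Fintype A] :
    (√(Fintype.card A) : ℂ) * (√(Fintype.card A) : ℂ) =
    Fintype.card A := by
  rw [← Complex.ofReal_mul, Real.mul_self_sqrt (Nat.cast_nonneg _), Complex.ofReal_natCast]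

variable {ι A : Type} [Fintype ι] [DecidableEq ι] [AddCommGroup A] [Fintype A] [DecidableEq A]

open Classical in
theorem AddChar.sum_star_mul (ψ φ : AddChar A ℂ) :
    ∑ x, star (ψ x) * φ x = if ψ = φ then (Fintype.card A : ℂ) else 0 := by
  have h : ∀ x, star (ψ x) * φ x = (φ - ψ) x := fun x => by
    rw [AddChar.sub_apply', mul_comm, div_eq_mul_inv, AddChar.inv_apply_eq_conj]
    rfl
  simp_rw [h, AddChar.sum_eq_ite, sub_eq_zero, eq_comm]

theorem AddChar.sum_star_apply_mul_apply (x y : A) :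
    ∑ ψ : AddChar A ℂ, star (ψ x) * ψ y = if x = y then (Fintype.card A : ℂ) else 0 := by
  have h : ∀ ψ : AddChar A ℂ, star (ψ x) * ψ y = ψ (y - x) := fun ψ => by
    rw [AddChar.map_sub_eq_div, mul_comm, div_eq_mul_inv, AddChar.inv_apply_eq_conj]
    rfl
  simp_rw [h, AddChar.sum_apply_eq_ite, sub_eq_zero, eq_comm]

/-- The character of the product group with the given components. -/
noncomputable def piChar (e : ι → AddChar A ℂ) (x : ι → A) : ℂ := ∏ j, e j (x j)

theorem norm_piChar (e : ι → AddChar A ℂ) (x : ι → A) : ‖piChar e x‖ = 1 := by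
  simp [piChar, norm_prod, AddChar.norm_apply]

/-- The unitary Fourier transform of the product group. -/
noncomputable def fourierMatrix (ι A : Type) [Fintype ι] [AddCommGroup A] [Fintype A] :
    Matrix (ι → AddChar A ℂ) (ι → A) ℂ :=
  piMatrix fun _ => Matrix.of fun ψ a => star (ψ a) / (√(Fintype.card A) : ℂ)

theorem sqrt_card_ne_zero : (√(Fintype.card A) : ℂ) ≠ 0 := by
  have : (0 : ℝ) < Fintype.card A := Nat.cast_pos.2 Fintype.card_pos
  exact Complex.ofReal_ne_zero.2 (Real.sqrt_pos.2 this).ne'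

theorem isometry_fourierMatrix : (fourierMatrix ι A)ᴴ * fourierMatrix ι A = 1 := by
  refine isometry_piMatrix fun _ => ?_
  rw [isometry_iff]
  intro u v
  have h : ∀ ψ : AddChar A ℂ, star (star (ψ u) / (√(Fintype.card A) : ℂ)) *
      (star (ψ v) / (√(Fintype.card A) : ℂ)) = star (ψ v) * ψ u / Fintype.card A := fun ψ => by
    rw [← sqrt_card_mul_self, star_div₀, star_star,
      show star (√(Fintype.card A) : ℂ) = √(Fintype.card A) from Complex.conj_ofReal _]
    ring
  simp only [of_apply, h]
  rw [← Finset.sum_div, AddChar.sum_star_apply_mul_apply, ite_div, zero_div, div_self]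
  · simp [eq_comm]
  · exact Nat.cast_ne_zero.2 Fintype.card_ne_zero

theorem fourierMatrix_apply (e : ι → AddChar A ℂ) (x : ι → A) :
    fourierMatrix ι A e x = star (piChar e x) / (√(Fintype.card A) : ℂ) ^ Fintype.card ι := by
  simp [fourierMatrix, piMatrix, piChar, Finset.prod_div_distrib]

theorem sum_piChar_mul_fourier (F : (ι → A) → ℂ) (x : ι → A) :
    ∑ e, piChar e x * (fourierMatrix ι A *ᵥ F) e =
      (√(Fintype.card A) : ℂ) ^ Fintype.card ι * F x := by
  simp only [mulVec, dotProduct, Finset.mul_sum]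
  rw [Finset.sum_comm, Finset.sum_eq_single x]
  · simp only [fourierMatrix_apply]
    have h : ∀ e : ι → AddChar A ℂ, piChar e x * (star (piChar e x) /
        (√(Fintype.card A) : ℂ) ^ Fintype.card ι * F x) =
        1 / (√(Fintype.card A) : ℂ) ^ Fintype.card ι * F x := fun e => by
      have : piChar e x * star (piChar e x) = 1 := by
        rw [Complex.star_def, Complex.mul_conj']
        simp [norm_piChar]
      rw [← mul_assoc, mul_div_assoc', this]
    simp only [h, Finset.sum_const, Finset.card_univ, Fintype.card_fun, AddChar.card_eq,
      nsmul_eq_mul, Nat.cast_pow, ← sqrt_card_mul_self]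
    rw [mul_pow]
    have := pow_ne_zero (Fintype.card ι) (sqrt_card_ne_zero (A := A))
    field_simp
  · intro y _ hy
    obtain ⟨j, hj⟩ := Function.ne_iff.1 hy
    simp only [fourierMatrix_apply, ← mul_assoc, mul_div_assoc']
    rw [← Finset.sum_mul, ← Finset.sum_div]
    have : ∑ e : ι → AddChar A ℂ, piChar e x * star (piChar e y) = 0 := by
      have h : ∀ e : ι → AddChar A ℂ, piChar e x * star (piChar e y) =
          ∏ j, star (e j (y j)) * e j (x j) := fun e => by
        rw [piChar, piChar, star_prod, Finset.prod_mul_distrib, mul_comm]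
      simp_rw [h]
      rw [sum_prod_pi (fun j (ψ : AddChar A ℂ) => star (ψ (y j)) * ψ (x j))]
      refine Finset.prod_eq_zero (Finset.mem_univ j) ?_
      rw [AddChar.sum_star_apply_mul_apply, if_neg hj]
    rw [this]
    simp
  · simp

/-! ### Measuring in a code, given a set of correctable dual errors -/

variable (C : AddSubgroup (ι → A)) [Fintype C] (good : (ι → AddChar A ℂ) → Prop)
  [DecidablePred good]

/-- Decode the correctable errors and go back to the code; keep the other errors. -/
noncomputable def decodeMatrix : Matrix (C ⊕ (ι → AddChar A ℂ)) (ι → AddChar A ℂ) ℂ :=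
  open Classical in
  Matrix.of fun ω e => Sum.elim
    (fun x : C => if good e then piChar e x / (√(Fintype.card C) : ℂ) else 0)
    (fun e' => if good e then 0 else if e' = e then 1 else 0) ω

/-- The squared distance from the ideal state, for the amplitudes `F`. -/
noncomputable def decodeDefect (F : (ι → A) → ℂ) : ℝ :=
  (∑ e, if good e then 0 else ‖(fourierMatrix ι A *ᵥ F) e‖ ^ 2) +
    (∑ x : C, ‖∑ e, if good e then 0 else piChar e x * (fourierMatrix ι A *ᵥ F) e‖ ^ 2) /
      Fintype.card C

variable {C good}

open Classical in
-- Good columns are normalised characters of `C`, orthogonal by `hgood`. The other columns are basis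
-- vectors in a separate block of rows, so they meet neither each other nor the good ones.
theorem isometry_decodeMatrix (hgood : ∀ e e', good e → good e' → e ≠ e' →
    ∑ x : C, star (piChar e x) * piChar e' x = 0) :
    (decodeMatrix C good)ᴴ * decodeMatrix C good = 1 := by
  have hC := sqrt_card_mul_self (A := C)
  have hC0 := sqrt_card_ne_zero (A := C)
  rw [isometry_iff]
  intro u v
  rw [Fintype.sum_sum_type]
  simp only [decodeMatrix, of_apply, Sum.elim_inl, Sum.elim_inr]
  have h1 : ∑ x : C, star (piChar u x / (√(Fintype.card C) : ℂ)) *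
      (piChar v x / (√(Fintype.card C) : ℂ)) =
      (∑ x : C, star (piChar u x) * piChar v x) / Fintype.card C := by
    rw [Finset.sum_div]
    refine Finset.sum_congr rfl fun x _ => ?_
    rw [← hC, star_div₀,
      show star (√(Fintype.card C) : ℂ) = √(Fintype.card C) from Complex.conj_ofReal _,
      div_mul_div_comm]
  by_cases hu : good u <;> by_cases hv : good v
  · simp only [hu, hv, if_true, h1]
    by_cases huv : u = v
    · subst huv
      have : ∀ x : C, star (piChar u x) * piChar u x = 1 := fun x => by
        rw [Complex.star_def, Complex.conj_mul']
        simp [norm_piChar]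
      rw [Finset.sum_congr rfl fun x _ => this x]
      simp
    · rw [hgood u v hu hv huv]
      simp [huv]
  · have : u ≠ v := fun h => hv (h ▸ hu)
    simp [hu, hv, this]
  · have : u ≠ v := fun h => hu (h ▸ hv)
    simp [hu, hv, this]
  · simp [hu, hv, eq_comm]

open Classical in
-- The isometry preserves the total weight of `F`, and there are only two ways to lose some of it:
-- the outcomes `Sum.inr`, which carry the mass of the errors that are not good, and the codewords
-- where `F` vanishes. These are the two terms of `decodeDefect`.
theorem le_sum_decode (hgood : ∀ e e', good e → good e' → e ≠ e' →
    ∑ x : C, star (piChar e x) * piChar e' x = 0) (F : (ι → A) → ℂ) :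
    ∑ x, ‖F x‖ ^ 2 - decodeDefect C good F ≤
      ∑ x : C, if F x = 0 then 0 else
        ‖((decodeMatrix C good * fourierMatrix ι A) *ᵥ F) (Sum.inl x)‖ ^ 2 := by
  set J := decodeMatrix C good * fourierMatrix ι A with hJ
  set Fh := fourierMatrix ι A *ᵥ F with hFh
  have iso := isometry_mul (isometry_decodeMatrix hgood) isometry_fourierMatrix
  have htot : ∑ ω, ‖(J *ᵥ F) ω‖ ^ 2 = _ := sum_norm_sq_mulVec iso F
  have hinl : ∀ x : C, (J *ᵥ F) (Sum.inl x) =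
      (∑ e, if good e then piChar e x * Fh e else 0) / (√(Fintype.card C) : ℂ) := fun x => by
    rw [hJ, ← mulVec_mulVec, Finset.sum_div]
    simp only [mulVec, dotProduct, decodeMatrix, of_apply, Sum.elim_inl]
    refine Finset.sum_congr rfl fun e _ => ?_
    split_ifs
    · rw [div_mul_eq_mul_div]
      rfl
    · simp
  have hinr : ∀ e, (J *ᵥ F) (Sum.inr e) = if good e then 0 else Fh e := fun e => by
    rw [hJ, ← mulVec_mulVec]
    simp only [mulVec, dotProduct, decodeMatrix, of_apply, Sum.elim_inr]
    rw [Finset.sum_eq_single e]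
    · by_cases he : good e <;> simp [he, hFh, mulVec, dotProduct]
    · intro b _ hb
      simp [Ne.symm hb]
    · simp
  -- By Fourier inversion the good and the remaining contributions add up to a multiple of `F x =
  -- 0`. The amplitude is therefore minus the remaining contribution.
  have hbad : ∀ x : C, F x = 0 → ‖(J *ᵥ F) (Sum.inl x)‖ ^ 2 =
      ‖∑ e, if good e then 0 else piChar e x * Fh e‖ ^ 2 / Fintype.card C := fun x hx => by
    have h0 : (∑ e, if good e then piChar e x * Fh e else 0) +
        (∑ e, if good e then 0 else piChar e x * Fh e) = 0 := by
      rw [← Finset.sum_add_distrib]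
      have := sum_piChar_mul_fourier F x
      rw [hx, mul_zero] at this
      refine Eq.trans (Finset.sum_congr rfl fun e _ => ?_) this
      split_ifs <;> simp [hFh]
    rw [hinl, eq_neg_of_add_eq_zero_left h0, norm_div, norm_neg, div_pow, Complex.norm_real,
      Real.norm_eq_abs, sq_abs, Real.sq_sqrt (Nat.cast_nonneg _)]
  rw [Fintype.sum_sum_type] at htot
  simp only [hinr] at htot
  have h2 : (∑ e, ‖if good e then 0 else Fh e‖ ^ 2) = ∑ e, if good e then 0 else ‖Fh e‖ ^ 2 :=
    Finset.sum_congr rfl fun e _ => by split_ifs <;> simp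
  have h3 : ∑ x : C, ‖(J *ᵥ F) (Sum.inl x)‖ ^ 2 ≤
      (∑ x : C, if F x = 0 then 0 else ‖(J *ᵥ F) (Sum.inl x)‖ ^ 2) +
      (∑ x : C, ‖∑ e, if good e then 0 else piChar e x * Fh e‖ ^ 2) / Fintype.card C := by
    rw [Finset.sum_div, ← Finset.sum_add_distrib]
    refine Finset.sum_le_sum fun x _ => ?_
    split_ifs with hx
    · rw [hbad x hx, zero_add]
    · exact le_add_of_nonneg_right (by positivity)
  have h4 : decodeDefect C good F = (∑ e, if good e then 0 else ‖Fh e‖ ^ 2) +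
    (∑ x : C, ‖∑ e, if good e then 0 else piChar e x * Fh e‖ ^ 2) / Fintype.card C := rfl
  rw [h2] at htot
  linarith

/-! ### Interpolating codes -/

/-- Errors of small weight are told apart by a code that interpolates on small sets. -/
theorem sum_star_piChar_mul_eq_zero (e e' : ι → AddChar A ℂ) (hne : e ≠ e')
    (hint : ∀ v : ι → A, ∃ c ∈ C, ∀ j, e j ≠ e' j → c j = v j) :
    ∑ x : C, star (piChar e x) * piChar e' x = 0 := by
  have hchar : ∀ x : ι → A, star (piChar e x) * piChar e' x = piChar (e' - e) x := fun x => by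
    simp only [piChar, star_prod, ← Finset.prod_mul_distrib]
    refine Finset.prod_congr rfl fun j _ => ?_
    rw [Pi.sub_apply, AddChar.sub_apply', mul_comm, div_eq_mul_inv, AddChar.inv_apply_eq_conj]
    rfl
  simp_rw [hchar]
  obtain ⟨i, hi⟩ := Function.ne_iff.1 hne
  obtain ⟨a, ha⟩ := AddChar.ne_zero_iff.1 (sub_ne_zero.2 (Ne.symm hi))
  -- On the support of `e' - e` the codeword `c` agrees with the word that is `a` at `i` and zero
  -- elsewhere. Hence the character takes a value other than 1 at `c`, and translating by `c` forces
  -- its sum over the code to vanish.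
  obtain ⟨c, hc, hcv⟩ := hint (Pi.single i a)
  have hval : piChar (e' - e) c = (e' i - e i) a := by
    rw [piChar, Finset.prod_eq_single i]
    · rw [hcv i hi, Pi.single_eq_same, Pi.sub_apply]
    · intro j _ hj
      by_cases h : e j = e' j
      · simp [h]
      · rw [hcv j h, Pi.single_eq_of_ne hj, AddChar.map_zero_eq_one]
    · simp
  have hadd : ∀ x y : ι → A, piChar (e' - e) (x + y) = piChar (e' - e) x * piChar (e' - e) y := by
    intro x y
    simp only [piChar, ← Finset.prod_mul_distrib, Pi.add_apply, AddChar.map_add_eq_mul]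
  have hshift : ∑ x : C, piChar (e' - e) x = (∑ x : C, piChar (e' - e) x) * (e' i - e i) a := by
    rw [← hval, Finset.sum_mul]
    refine (Equiv.sum_comp (Equiv.addRight (⟨c, hc⟩ : C))
      (fun x => piChar (e' - e) x)).symm.trans ?_
    refine Finset.sum_congr rfl fun x _ => ?_
    simp [hadd]
  have : (∑ x : C, piChar (e' - e) x) * ((e' i - e i) a - 1) = 0 := by
    rw [mul_sub, ← hshift, mul_one, sub_self]
  exact (mul_eq_zero.1 this).resolve_right (sub_ne_zero.2 ha)

end Fourier

/-! ### Averaging over a random family -/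

section Averaging

open Matrix

set_option linter.unusedSectionVars false

variable {ι A K : Type} [Fintype ι] [DecidableEq ι] [AddCommGroup A] [Fintype A] [DecidableEq A]
  [Fintype K]

/-- A family of zero-one valued random variables whose joint moments of order at most `d` are those
of independent variables with expectation `ρ`. -/
structure IsBernoulliFamily {Z : Type} (f : K → Z → ℝ) (ρ : ℝ) (d : ℕ) : Prop where
  zero_or_one : ∀ k p, f k p = 0 ∨ f k p = 1
  moment : ∀ P : Finset Z, P.card ≤ d → ∑ k, ∏ p ∈ P, f k p = Fintype.card K * ρ ^ P.card

namespace IsBernoulliFamily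

variable {f : K → ι × A → ℝ} {ρ : ℝ}

theorem mul_self {Z : Type} {f : K → Z → ℝ} {d : ℕ} (hf : IsBernoulliFamily f ρ d) (k : K)
    (p : Z) : f k p * f k p = f k p := by
  rcases hf.zero_or_one k p with h | h <;> simp [h]

theorem sum_mul {Z : Type} [DecidableEq Z] {f : K → Z → ℝ} {d : ℕ} (hf : IsBernoulliFamily f ρ d)
    (hd : 2 ≤ d) (p q : Z) :
    ∑ k, f k p * f k q = Fintype.card K * (if p = q then ρ else ρ ^ 2) := by
  by_cases h : p = q
  · subst h
    have := hf.moment {p} (by simp; omega)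
    simpa [hf.mul_self] using this
  · have := hf.moment {p, q} (by rw [Finset.card_pair h]; exact hd)
    simpa [h, Finset.prod_pair, Finset.card_pair] using this

/-- Chebyshev's estimate of the sum of the variables of one coordinate. -/
theorem sum_sub_sq (hf : IsBernoulliFamily f ρ (2 * Fintype.card ι)) (j : ι) :
    ∑ k, (∑ a, f k (j, a) - ρ * Fintype.card A) ^ 2 =
      Fintype.card K * ((ρ - ρ ^ 2) * Fintype.card A) := by
  have hd : 2 ≤ 2 * Fintype.card ι := by
    have : 0 < Fintype.card ι := Fintype.card_pos_iff.2 ⟨j⟩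
    omega
  have h1 : ∀ a : A, ∑ k, f k (j, a) = Fintype.card K * ρ := fun a => by
    simpa [hf.mul_self] using hf.sum_mul hd (j, a) (j, a)
  have h2 : ∑ k, (∑ a, f k (j, a)) ^ 2 =
      Fintype.card K * (ρ ^ 2 * Fintype.card A ^ 2 + (ρ - ρ ^ 2) * Fintype.card A) := by
    simp_rw [sq (∑ a, f _ _), Finset.sum_mul_sum]
    rw [Finset.sum_comm]
    have h3 : ∀ a : A, ∑ k, ∑ b, f k (j, a) * f k (j, b) =
        Fintype.card K * (ρ ^ 2 * Fintype.card A + (ρ - ρ ^ 2)) := fun a => by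
      rw [Finset.sum_comm]
      simp_rw [hf.sum_mul hd]
      have h4 : ∀ b : A, (if (j, a) = (j, b) then ρ else ρ ^ 2) =
          ρ ^ 2 + if a = b then ρ - ρ ^ 2 else 0 := fun b => by
        by_cases h : a = b <;> simp [h]
      simp_rw [h4]
      rw [← Finset.mul_sum, Finset.sum_add_distrib]
      simp [mul_comm]
    simp only [h3, Finset.sum_const, Finset.card_univ, nsmul_eq_mul]
    ring
  have h5 : ∑ k, ∑ a, f k (j, a) = Fintype.card A * (Fintype.card K * ρ) := by
    rw [Finset.sum_comm]
    simp [h1]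
  simp_rw [sub_sq]
  rw [Finset.sum_add_distrib, Finset.sum_sub_distrib, h2]
  have h6 : ∑ k, 2 * (∑ a, f k (j, a)) * (ρ * Fintype.card A) =
      2 * (Fintype.card A * (Fintype.card K * ρ)) * (ρ * Fintype.card A) := by
    rw [← h5, Finset.mul_sum, Finset.sum_mul]
  rw [h6]
  simp only [Finset.sum_const, Finset.card_univ, nsmul_eq_mul]
  ring

/-- The mixed moments of the product amplitudes. -/
theorem sum_prod_mul_prod (hf : IsBernoulliFamily f ρ (2 * Fintype.card ι)) (x y : ι → A) :
    ∑ k, (∏ j, f k (j, x j)) * ∏ j, f k (j, y j) =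
      Fintype.card K * ∏ j, if x j = y j then ρ else ρ ^ 2 := by
  -- At most two variables occur per coordinate, which explains the order `2 * Fintype.card ι`.
  -- Where `x j = y j` they coincide, and idempotence replaces the square by the variable itself.
  let P : Finset (ι × A) := Finset.univ.biUnion fun j => {(j, x j), (j, y j)}
  have hdisj : Set.PairwiseDisjoint (↑(Finset.univ : Finset ι))
      (fun j => ({(j, x j), (j, y j)} : Finset (ι × A))) := by
    intro i _ j _ hij
    simp [Function.onFun, hij.symm]
  have hP : P.card ≤ 2 * Fintype.card ι := by
    refine Finset.card_biUnion_le.trans ?_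
    calc _ ≤ ∑ _j : ι, 2 := Finset.sum_le_sum fun j _ => Finset.card_le_two
      _ = _ := by simp [mul_comm]
  have h1 : ∀ g : ι × A → ℝ, ∏ p ∈ P, g p =
      ∏ j, if x j = y j then g (j, x j) else g (j, x j) * g (j, y j) := fun g => by
    rw [Finset.prod_biUnion hdisj]
    refine Finset.prod_congr rfl fun j _ => ?_
    split_ifs with h
    · simp [h]
    · rw [Finset.prod_pair (by simpa using h)]
  have h2 := hf.moment P hP
  rw [← Finset.prod_const, h1] at h2
  simp_rw [h1, ← sq] at h2
  rw [← h2]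
  refine Finset.sum_congr rfl fun k _ => ?_
  rw [← Finset.prod_mul_distrib]
  refine Finset.prod_congr rfl fun j _ => ?_
  split_ifs with h
  · rw [h, hf.mul_self]
  · rfl

/-- The expected squared modulus of a Fourier coefficient. -/
noncomputable def spectralWeight (ρ : ℝ) (ψ : AddChar A ℂ) : ℝ :=
  open Classical in
  (ρ - ρ ^ 2) + if ψ = 0 then ρ ^ 2 * Fintype.card A else 0

open Classical in
-- The second-moment matrix of one coordinate is ρ² times the all-ones matrix plus ρ - ρ² times the
-- identity. It is translation invariant, so the characters diagonalise it, and the all-ones part is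
-- seen only by the trivial character.
theorem sum_sum_fourier_mul (ψ φ : AddChar A ℂ) :
    ∑ a, ∑ b, (star (ψ a) / (√(Fintype.card A) : ℂ)) * star (star (φ b) / (√(Fintype.card A) : ℂ)) *
      ((if a = b then ρ else ρ ^ 2 : ℝ) : ℂ) = if ψ = φ then (spectralWeight ρ ψ : ℂ) else 0 := by
  have hA : (Fintype.card A : ℂ) ≠ 0 := Nat.cast_ne_zero.2 Fintype.card_ne_zero
  have h1 : ∀ a b : A, (star (ψ a) / (√(Fintype.card A) : ℂ)) *
      star (star (φ b) / (√(Fintype.card A) : ℂ)) * ((if a = b then ρ else ρ ^ 2 : ℝ) : ℂ) =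
      (star (ψ a) * φ b) * (ρ ^ 2 / Fintype.card A) +
      if a = b then (star (ψ a) * φ a) * ((ρ - ρ ^ 2) / Fintype.card A) else 0 := fun a b => by
    rw [← sqrt_card_mul_self, star_div₀, star_star,
      show star (√(Fintype.card A) : ℂ) = √(Fintype.card A) from Complex.conj_ofReal _]
    by_cases h : a = b
    · subst h
      simp
      ring
    · simp [h]
      ring
  have hstar : ∑ a, star (ψ a) = if ψ = 0 then (Fintype.card A : ℂ) else 0 := by
    rw [← star_sum, AddChar.sum_eq_ite]
    split_ifs <;> simp
  simp_rw [h1, Finset.sum_add_distrib]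
  simp_rw [← Finset.sum_mul, ← Finset.mul_sum]
  rw [← Finset.sum_mul, hstar, AddChar.sum_eq_ite]
  simp only [Finset.sum_ite_eq, Finset.mem_univ, if_true]
  rw [← Finset.sum_mul, AddChar.sum_star_mul]
  unfold spectralWeight
  by_cases h : ψ = φ
  · subst h
    by_cases h0 : ψ = 0
    · simp [h0]
      field_simp
      ring
    · simp [h0]
      field_simp
  · by_cases h0 : ψ = 0
    · have : φ ≠ 0 := fun h' => h (h0.trans h'.symm)
      simp [h, this]
    · simp [h, h0]

open Classical in
-- The second moments of the product amplitudes factor over the coordinates, so the one-coordinate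
-- diagonalisation gives uncorrelated Fourier coefficients with product variances.
theorem sum_fourier_mul_star (hf : IsBernoulliFamily f ρ (2 * Fintype.card ι))
    (e e' : ι → AddChar A ℂ) :
    ∑ k, (fourierMatrix ι A *ᵥ fun x => ∏ j, (f k (j, x j) : ℂ)) e *
      star ((fourierMatrix ι A *ᵥ fun x => ∏ j, (f k (j, x j) : ℂ)) e') =
      if e = e' then Fintype.card K * ((∏ j, spectralWeight ρ (e j) : ℝ) : ℂ) else 0 := by
  have hm : ∀ x y : ι → A, ∑ k, (∏ j, (f k (j, x j) : ℂ)) * ∏ j, (f k (j, y j) : ℂ) =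
      Fintype.card K * ∏ j, ((if x j = y j then ρ else ρ ^ 2 : ℝ) : ℂ) := fun x y => by
    have := congrArg (fun r : ℝ => (r : ℂ)) (hf.sum_prod_mul_prod x y)
    simpa using this
  have h1 : ∀ k, (fourierMatrix ι A *ᵥ fun x => ∏ j, (f k (j, x j) : ℂ)) e *
      star ((fourierMatrix ι A *ᵥ fun x => ∏ j, (f k (j, x j) : ℂ)) e') =
      ∑ x, ∑ y, fourierMatrix ι A e x * star (fourierMatrix ι A e' y) *
        ((∏ j, (f k (j, x j) : ℂ)) * ∏ j, (f k (j, y j) : ℂ)) := fun k => by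
    simp only [mulVec, dotProduct, star_sum, Finset.sum_mul_sum]
    refine Finset.sum_congr rfl fun x _ => Finset.sum_congr rfl fun y _ => ?_
    simp only [star_mul', star_prod, Complex.star_def, Complex.conj_ofReal]
    ring
  simp_rw [h1]
  rw [Finset.sum_comm]
  have h2 : ∀ x, ∑ k, ∑ y, fourierMatrix ι A e x * star (fourierMatrix ι A e' y) *
        ((∏ j, (f k (j, x j) : ℂ)) * ∏ j, (f k (j, y j) : ℂ)) =
      Fintype.card K * ∏ j, ∑ b, (star (e j (x j)) / (√(Fintype.card A) : ℂ)) *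
        star (star (e' j b) / (√(Fintype.card A) : ℂ)) *
        ((if x j = b then ρ else ρ ^ 2 : ℝ) : ℂ) := fun x => by
    rw [Finset.sum_comm]
    simp_rw [← Finset.mul_sum, hm]
    rw [← sum_prod_pi (fun j b => (star (e j (x j)) / (√(Fintype.card A) : ℂ)) *
        star (star (e' j b) / (√(Fintype.card A) : ℂ)) *
        ((if x j = b then ρ else ρ ^ 2 : ℝ) : ℂ)), Finset.mul_sum]
    refine Finset.sum_congr rfl fun y _ => ?_
    simp only [fourierMatrix, piMatrix, of_apply, star_prod, Finset.prod_mul_distrib]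
    ring
  simp_rw [h2]
  rw [← Finset.mul_sum, sum_prod_pi (fun j a => ∑ b, (star (e j a) / (√(Fintype.card A) : ℂ)) *
        star (star (e' j b) / (√(Fintype.card A) : ℂ)) *
        ((if a = b then ρ else ρ ^ 2 : ℝ) : ℂ))]
  simp_rw [sum_sum_fourier_mul]
  by_cases h : e = e'
  · subst h
    simp
  · obtain ⟨j, hj⟩ := Function.ne_iff.1 h
    rw [if_neg h, Finset.prod_eq_zero (Finset.mem_univ j) (if_neg hj), mul_zero]

open Classical in
-- When the square is expanded, the off-diagonal terms average to zero.
theorem sum_norm_sq_sum_fourier (hf : IsBernoulliFamily f ρ (2 * Fintype.card ι))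
    (c : (ι → AddChar A ℂ) → ℂ) :
    ∑ k, ‖∑ e, c e * (fourierMatrix ι A *ᵥ fun x => ∏ j, (f k (j, x j) : ℂ)) e‖ ^ 2 =
      Fintype.card K * ∑ e, ‖c e‖ ^ 2 * ∏ j, spectralWeight ρ (e j) := by
  apply Complex.ofReal_injective
  push_cast
  have h1 : ∀ z : ℂ, (‖z‖ : ℂ) ^ 2 = z * star z := fun z => (Complex.mul_conj' z).symm
  simp_rw [h1, star_sum, Finset.sum_mul_sum]
  rw [Finset.sum_comm, Finset.mul_sum]
  refine Finset.sum_congr rfl fun e _ => ?_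
  rw [Finset.sum_comm, Finset.sum_eq_single e]
  · have := hf.sum_fourier_mul_star e e
    rw [if_pos rfl] at this
    push_cast at this
    rw [mul_left_comm, ← this, Finset.mul_sum]
    refine Finset.sum_congr rfl fun k _ => ?_
    rw [star_mul']
    ring
  · intro e' _ he'
    have := hf.sum_fourier_mul_star e e'
    rw [if_neg (Ne.symm he')] at this
    have h2 : ∀ k, c e * (fourierMatrix ι A *ᵥ fun x => ∏ j, (f k (j, x j) : ℂ)) e *
        star (c e' * (fourierMatrix ι A *ᵥ fun x => ∏ j, (f k (j, x j) : ℂ)) e') =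
        (c e * star (c e')) * ((fourierMatrix ι A *ᵥ fun x => ∏ j, (f k (j, x j) : ℂ)) e *
        star ((fourierMatrix ι A *ᵥ fun x => ∏ j, (f k (j, x j) : ℂ)) e')) := fun k => by
      rw [star_mul']
      ring
    simp_rw [h2]
    rw [← Finset.mul_sum, this, mul_zero]
  · simp

/-- Both parts of the defect have the same mean, because characters have modulus one and the
coefficients are uncorrelated; hence the factor 2. -/
theorem sum_decodeDefect (hf : IsBernoulliFamily f ρ (2 * Fintype.card ι))
    (C : AddSubgroup (ι → A)) [Fintype C] (good : (ι → AddChar A ℂ) → Prop) [DecidablePred good] :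
    ∑ k, decodeDefect C good (fun x => ∏ j, (f k (j, x j) : ℂ)) =
      2 * (Fintype.card K * ∑ e, if good e then 0 else ∏ j, spectralWeight ρ (e j)) := by
  classical
  unfold decodeDefect
  rw [Finset.sum_add_distrib]
  have h1 : ∑ k, (∑ e, if good e then 0 else
      ‖(fourierMatrix ι A *ᵥ fun x => ∏ j, (f k (j, x j) : ℂ)) e‖ ^ 2) =
      Fintype.card K * ∑ e, if good e then 0 else ∏ j, spectralWeight ρ (e j) := by
    rw [Finset.sum_comm, Finset.mul_sum]
    refine Finset.sum_congr rfl fun e _ => ?_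
    split_ifs
    · simp
    · have := hf.sum_norm_sq_sum_fourier (Pi.single e 1)
      simpa [Pi.single_apply, apply_ite norm, ite_pow] using this
  have h2 : ∀ x : C, ∑ k, ‖∑ e, if good e then 0 else piChar e x *
      (fourierMatrix ι A *ᵥ fun x => ∏ j, (f k (j, x j) : ℂ)) e‖ ^ 2 =
      Fintype.card K * ∑ e, if good e then 0 else ∏ j, spectralWeight ρ (e j) := fun x => by
    have := hf.sum_norm_sq_sum_fourier (fun e => if good e then 0 else piChar e x)
    simp only [ite_mul, zero_mul] at this
    rw [this]
    congr 1
    refine Finset.sum_congr rfl fun e _ => ?_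
    split_ifs <;> simp [norm_piChar]
  rw [h1, ← Finset.sum_div, Finset.sum_comm]
  simp only [h2, Finset.sum_const, Finset.card_univ, nsmul_eq_mul]
  have hC : (Fintype.card C : ℝ) ≠ 0 := Nat.cast_ne_zero.2 Fintype.card_ne_zero
  field_simp
  ring

end IsBernoulliFamily

/-- The number of components on which a character of the product group is nontrivial. -/
noncomputable def charWeight (e : ι → AddChar A ℂ) : ℕ :=
  open Classical in (Finset.univ.filter fun j => e j ≠ 0).card

open IsBernoulliFamily in
/-- The spectral weight of the high-weight characters is exponentially small. -/
theorem sum_spectralWeight_tail_le :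
    (∑ e : ι → AddChar A ℂ, if 20 * charWeight e ≤ Fintype.card ι then 0
      else ∏ j, spectralWeight (63 / 64) (e j)) ≤
      (962 / 1000 * Fintype.card A) ^ Fintype.card ι := by
  classical
  set n := Fintype.card ι with hn
  -- Chernoff tilt: a character of weight w contributes an extra factor `lam ^ w`, which exceeds
  -- (21/20)^n once 20w > n. The compensating factor (20/21)^n then bounds the indicator of the
  -- tail, and the sum factors over the coordinates.
  set lam : ℝ := (21 / 20) ^ 20 with hlam
  have hw : ∀ ψ : AddChar A ℂ, 0 ≤ spectralWeight (63 / 64) ψ := fun ψ => by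
    unfold spectralWeight
    split_ifs <;> positivity
  have hlam1 : (1 : ℝ) ≤ lam := one_le_pow₀ (by norm_num)
  have hA : (1 : ℝ) ≤ Fintype.card A := Nat.one_le_cast.2 Fintype.card_pos
  calc _ ≤ ∑ e : ι → AddChar A ℂ, (20 / 21) ^ n *
        ∏ j, (if e j ≠ 0 then lam else 1) * spectralWeight (63 / 64) (e j) := by
        refine Finset.sum_le_sum fun e _ => ?_
        have hp : 0 ≤ ∏ j, spectralWeight (63 / 64) (e j) := Finset.prod_nonneg fun j _ => hw _
        have hprod : ∏ j, (if e j ≠ 0 then lam else 1) = lam ^ charWeight e := by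
          rw [Finset.prod_ite]
          simp [charWeight]
        rw [Finset.prod_mul_distrib, hprod]
        split_ifs with h
        · positivity
        · have h1 : (1 : ℝ) ≤ (20 / 21) ^ n * lam ^ charWeight e := by
            rw [hlam, ← pow_mul]
            calc (1 : ℝ) = (20 / 21) ^ n * (21 / 20) ^ n := by
                  rw [← mul_pow]
                  norm_num
              _ ≤ _ := by
                  gcongr
                  · norm_num
                  · omega
          calc _ ≤ ((20 / 21) ^ n * lam ^ charWeight e) *
                ∏ j, spectralWeight (63 / 64) (e j) := le_mul_of_one_le_left hp h1
            _ = _ := by ring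
    _ = (20 / 21 * ∑ ψ : AddChar A ℂ, (if ψ ≠ 0 then lam else 1) *
          spectralWeight (63 / 64) ψ) ^ n := by
        rw [← Finset.mul_sum, sum_prod_pi (fun (_ : ι) (ψ : AddChar A ℂ) =>
          (if ψ ≠ 0 then lam else 1) * spectralWeight (63 / 64) ψ), Finset.prod_const,
          Finset.card_univ, mul_pow]
    _ ≤ _ := by
        have hsum : ∑ ψ : AddChar A ℂ, (if ψ ≠ 0 then lam else 1) * spectralWeight (63 / 64) ψ ≤
            Fintype.card A * (lam * (63 / 64 - (63 / 64) ^ 2)) +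
              (63 / 64) ^ 2 * Fintype.card A := by
          calc _ ≤ ∑ ψ : AddChar A ℂ, (lam * (63 / 64 - (63 / 64) ^ 2) +
                if ψ = 0 then (63 / 64) ^ 2 * (Fintype.card A : ℝ) else 0) := by
                refine Finset.sum_le_sum fun ψ _ => ?_
                unfold spectralWeight
                by_cases h : ψ = 0
                · simp only [h, ne_eq, not_true_eq_false, if_false, if_true]
                  nlinarith
                · simp [h]
            _ = _ := by
                rw [Finset.sum_add_distrib]
                simp
        refine pow_le_pow_left₀ ?_ ?_ n
        · refine mul_nonneg (by norm_num) (Finset.sum_nonneg fun ψ _ => mul_nonneg ?_ (hw ψ))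
          split_ifs <;> linarith
        -- Numerically the left side is about 0.9617. Being below 39/40 is what matters later, when
        -- the tail is divided by the weight of `F`.
        · have hc : 20 / 21 * (lam * (63 / 64 - (63 / 64) ^ 2) + (63 / 64) ^ 2) ≤ 962 / 1000 := by
            rw [hlam]
            norm_num
          nlinarith

end Averaging

/-! ### The hash family -/

section Hash

/-- Averaging over the fibres of a surjective homomorphism of finite groups. -/
theorem card_mul_sum_comp_of_surjective {G M : Type} [AddGroup G] [Fintype G] [AddGroup M]
    [Fintype M] (φ : G →+ M) (hφ : Function.Surjective φ) (g : M → ℝ) :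
    (Fintype.card M : ℝ) * ∑ x, g (φ x) = Fintype.card G * ∑ y, g y := by
  classical
  have hfib : ∀ y, (Finset.univ.filter fun x => φ x = y).card =
      (Finset.univ.filter fun x => φ x = 0).card := fun y =>
    AddMonoidHom.card_fiber_eq_of_mem_range φ (hφ y) (hφ 0)
  have hG : Fintype.card G = Fintype.card M * (Finset.univ.filter fun x => φ x = 0).card := by
    rw [← Finset.card_univ, Finset.card_eq_sum_card_fiberwise (f := φ) (t := Finset.univ)
      (fun _ _ => Finset.mem_coe.2 (Finset.mem_univ _))]
    simp [hfib]
  have hsum : ∑ x, g (φ x) = (Finset.univ.filter fun x => φ x = 0).card * ∑ y, g y := by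
    rw [← Finset.sum_fiberwise Finset.univ φ, Finset.mul_sum]
    refine Finset.sum_congr rfl fun y _ => ?_
    rw [Finset.sum_congr rfl (g := fun _ => g y)
      (fun x hx => by rw [(Finset.mem_filter.1 hx).2])]
    simp [hfib]
  rw [hsum, hG]
  push_cast
  ring

/-- Polynomials with fewer than `d` coefficients are independent at any `d` points. -/
theorem exists_coeff_eval_eq {L : Type} [Field L] {d : ℕ} (hd : 0 < d) (P : Finset L)
    (hP : P.card ≤ d) (w : L → L) :
    ∃ k : Fin d → L, ∀ z ∈ P, ∑ i, k i * z ^ (i : ℕ) = w z := by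
  classical
  set p := Lagrange.interpolate P id w with hp
  have hinj : Set.InjOn (id : L → L) P := Function.injective_id.injOn
  have hdeg : p.natDegree < d := by
    by_cases h0 : p = 0
    · rw [h0]
      simpa using hd
    · rw [Polynomial.natDegree_lt_iff_degree_lt h0]
      exact (Lagrange.degree_interpolate_lt w hinj).trans_le (by exact_mod_cast hP)
  refine ⟨fun i => p.coeff i, fun z hz => ?_⟩
  have h1 := Lagrange.eval_interpolate_at_node (s := P) (v := id) w hinj hz
  rw [← h1, id, ← hp, Polynomial.eval_eq_sum_range' hdeg, Finset.sum_range]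

/-- Evaluation at at most `d` distinct points is a surjective homomorphism from the coefficient
vectors, so a uniform key gives independent uniform values at these points. -/
theorem sum_prod_poly_eval {L Z : Type} [Field L] [Fintype L] {d : ℕ} (hd : 0 < d) (enc : Z ↪ L)
    (g : Z → L → ℝ) (P : Finset Z) (hP : P.card ≤ d) :
    ∑ k : Fin d → L, ∏ p ∈ P, g p (∑ i, k i * enc p ^ (i : ℕ)) =
      Fintype.card (Fin d → L) * ∏ p ∈ P, (∑ v, g p v) / Fintype.card L := by
  classical
  let φ : (Fin d → L) →+ (P → L) :=
    { toFun := fun (k : Fin d → L) (p : P) => ∑ i : Fin d, k i * enc p ^ (i : ℕ)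
      map_zero' := by
        ext p
        simp
      map_add' := fun k l => by
        ext p
        simp [add_mul, Finset.sum_add_distrib] }
  have hφ : Function.Surjective φ := fun w => by
    obtain ⟨k, hk⟩ := exists_coeff_eval_eq hd (P.map enc) (by simpa using hP)
      (fun z => if h : ∃ p : P, enc p = z then w h.choose else 0)
    refine ⟨k, funext fun p => ?_⟩
    have h : ∃ q : P, enc q = enc p := ⟨p, rfl⟩
    have h2 : h.choose = p := Subtype.ext (enc.injective h.choose_spec)
    have := hk (enc p) (Finset.mem_map_of_mem _ p.2)
    rw [dif_pos h, h2] at this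
    exact this
  have key := card_mul_sum_comp_of_surjective φ hφ (fun w => ∏ p : P, g p (w p))
  rw [sum_prod_pi (fun (p : P) v => g p v)] at key
  have h1 : ∀ k, ∏ p ∈ P, g p (∑ i : Fin d, k i * enc p ^ (i : ℕ)) =
      ∏ p : P, g p (φ k p) := fun k =>
    (Finset.prod_coe_sort P (fun p => g p (∑ i, k i * enc p ^ (i : ℕ)))).symm
  rw [Finset.prod_coe_sort P (fun p => ∑ v, g p v)] at key
  simp_rw [h1]
  have hL : (Fintype.card L : ℝ) ≠ 0 := Nat.cast_ne_zero.2 Fintype.card_ne_zero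
  rw [Finset.prod_div_distrib, Finset.prod_const, mul_div_assoc', eq_div_iff (pow_ne_zero _ hL),
    ← key]
  simp [mul_comm]

theorem andXor_eq_true_iff (u v : Fin 6 → Bool) : andXor u v = true ↔ v = fun b => !u b := by
  simp only [andXor, decide_eq_true_eq, funext_iff]
  refine forall_congr' fun b => ?_
  cases u b <;> cases v b <;> simp

theorem andXor_comm (u v : Fin 6 → Bool) : andXor u v = andXor v u := by
  simp [andXor, Bool.xor_comm]

theorem sum_andXor (u : Fin 6 → Bool) :
    ∑ v : Fin 6 → Bool, (if andXor u v = false then (1 : ℝ) else 0) = 63 := by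
  have h : ∀ v : Fin 6 → Bool, (if andXor u v = false then (1 : ℝ) else 0) =
      1 - if v = (fun b => !u b) then 1 else 0 := fun v => by
    by_cases hv : v = fun b => !u b
    · rw [(andXor_eq_true_iff u v).2 hv]
      simp [hv]
    · rw [Bool.eq_false_iff.2 (mt (andXor_eq_true_iff u v).1 hv)]
      simp [hv]
  simp_rw [h, Finset.sum_sub_distrib]
  simp
  norm_num

theorem sum_comp_castLE {l : ℕ} (hl : 6 ≤ l) (g : (Fin 6 → Bool) → ℝ) :
    ∑ w : Fin l → Bool, g (fun b => w (Fin.castLE hl b)) = 2 ^ l / 64 * ∑ v, g v := by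
  obtain ⟨r, rfl⟩ := Nat.exists_eq_add_of_le hl
  rw [← (Fin.appendEquiv 6 r).sum_comp, Fintype.sum_prod_type]
  have h : ∀ (x : Fin 6 → Bool) (y : Fin r → Bool),
      (fun b => Fin.appendEquiv 6 r (x, y) (Fin.castLE hl b)) = x := fun x y => by
    ext b
    exact Fin.append_left x y b
  simp_rw [h]
  simp only [Finset.sum_const, Finset.card_univ, nsmul_eq_mul, ← Finset.mul_sum,
    Fintype.card_fun, Fintype.card_bool, Fintype.card_fin]
  rw [pow_add]
  push_cast
  ring

/-- The polynomial hash family, compared with fixed functions, is a Bernoulli family. -/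
theorem isBernoulliFamily_polyHash {s : ℕ} (hs : 1 ≤ s) [Fintype (HashField s)]
    (enc : Alphabet s × Fin (codeLength s) ↪ HashField s)
    (bits : HashField s ≃ (Fin (hashBits s) → Bool))
    (H : Fin (codeLength s) → Alphabet s → Fin 6 → Bool) :
    IsBernoulliFamily (fun (k : HashKey s) (p : Fin (codeLength s) × Alphabet s) =>
      if andXor (H p.1 p.2) (polyHash enc bits k p.2 p.1) = false then (1 : ℝ) else 0) (63 / 64)
      (codeLength s ^ 2) := by
  have hl : 6 ≤ hashBits s := le_max_right _ _
  constructor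
  · intro k p
    split_ifs <;> simp
  · intro P hP
    have hn : 0 < codeLength s ^ 2 := by
      have : 1 < 2 ^ s := Nat.one_lt_two_pow (by omega)
      exact pow_pos (by unfold codeLength; omega) 2
    have hcard : (Fintype.card (HashField s) : ℝ) = 2 ^ hashBits s := by
      rw [Fintype.card_congr bits]
      simp
    let enc' : Fin (codeLength s) × Alphabet s ↪ HashField s :=
      (Equiv.prodComm _ _).toEmbedding.trans enc
    have := sum_prod_poly_eval hn enc'
      (fun p v => if andXor (H p.1 p.2)
        (fun b => bits v (Fin.castLE (hl) b)) = false then (1 : ℝ) else 0) P hP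
    have h2 : ∀ p : Fin (codeLength s) × Alphabet s, (∑ v, if andXor (H p.1 p.2)
        (fun b => bits v (Fin.castLE (hl) b)) = false then (1 : ℝ) else 0) /
        Fintype.card (HashField s) = 63 / 64 := fun p => by
      rw [bits.sum_comp (fun w => if andXor (H p.1 p.2)
        (fun b => w (Fin.castLE (hl) b)) = false then (1 : ℝ) else 0),
        sum_comp_castLE (hl)
        (fun u => if andXor (H p.1 p.2) u = false then (1 : ℝ) else 0), sum_andXor, hcard]
      field_simp
    simp only [h2, Finset.prod_const] at this
    exact this

theorem IsBernoulliFamily.mono {K Z : Type} [Fintype K] {f : K → Z → ℝ} {ρ : ℝ} {d d' : ℕ}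
    (hf : IsBernoulliFamily f ρ d) (h : d' ≤ d) : IsBernoulliFamily f ρ d' :=
  ⟨hf.zero_or_one, fun P hP => hf.moment P (hP.trans h)⟩

end Hash

/-! ### The folded Reed--Solomon code -/

section Code

theorem codeLength_pos {s : ℕ} (hs : 1 ≤ s) : 0 < codeLength s := by
  have : 1 < 2 ^ s := Nat.one_lt_two_pow (by omega)
  unfold codeLength
  omega

theorem codeLength_mul_foldSize (s : ℕ) : codeLength s * foldSize s = 2 ^ (2 * s) - 1 := by
  unfold codeLength foldSize
  rw [mul_comm 2 s, pow_mul, mul_comm, ← one_pow 2, Nat.sq_sub_sq, one_pow]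

/-- The folded code as an additive group. -/
def nullCodeGroup (s : ℕ) (a γ : CodeField s) :
    AddSubgroup (Fin (codeLength s) → Alphabet s) where
  carrier := nullCode s a γ
  zero_mem' := ⟨0, by simp, fun i => by simp⟩
  add_mem' := by
    rintro x y ⟨f, hf, hx⟩ ⟨g, hg, hy⟩
    refine ⟨f + g, (Polynomial.natDegree_add_le f g).trans (max_le hf hg), fun i => ?_⟩
    rw [Polynomial.eval_add, ← hx i, ← hy i]
    rfl
  neg_mem' := by
    rintro x ⟨f, hf, hx⟩
    refine ⟨-f, by rwa [Polynomial.natDegree_neg], fun i => ?_⟩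
    rw [Polynomial.eval_neg, ← hx i]
    rfl

/-- The order of the generator γ is q - 1 = N, so its powers with exponents below N are distinct.
The point `a` takes the place of γ^0: it either equals 1 or is 0, which is no power of γ. -/
theorem evaluationPoint_injective {s : ℕ} (hs : 1 ≤ s) (γ : (CodeField s)ˣ)
    (hγ : ∀ u : (CodeField s)ˣ, u ∈ Subgroup.zpowers γ) (a : CodeField s) (ha : a = 0 ∨ a = 1) :
    Function.Injective fun i : Fin (codeLength s * foldSize s) =>
      if (i : ℕ) = 0 then a else (γ : CodeField s) ^ (i : ℕ) := by
  have hord : orderOf γ = codeLength s * foldSize s := by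
    rw [orderOf_eq_card_of_forall_mem_zpowers hγ, Nat.card_units, GaloisField.card 2 _ (by omega),
      codeLength_mul_foldSize]
  have hinj : ∀ i j : ℕ, i < codeLength s * foldSize s → j < codeLength s * foldSize s →
      (γ : CodeField s) ^ i = (γ : CodeField s) ^ j → i = j := fun i j hi hj h => by
    refine pow_injOn_Iio_orderOf (x := γ) (by simpa [hord] using hi) (by simpa [hord] using hj) ?_
    exact Units.ext (by simpa using h)
  have h0 : ∀ i : Fin (codeLength s * foldSize s), (i : ℕ) ≠ 0 →
      a ≠ (γ : CodeField s) ^ (i : ℕ) := by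
    rintro i hi h
    rcases ha with rfl | rfl
    · exact pow_ne_zero _ γ.ne_zero h.symm
    · exact hi (hinj i 0 i.2 (by omega) (by rw [← h, pow_zero]))
  intro i j hij
  dsimp only at hij
  apply Fin.ext
  split_ifs at hij with hi hj hj
  · omega
  · exact absurd hij (h0 j hj)
  · exact absurd hij.symm (h0 i hi)
  · exact hinj i j i.2 j.2 hij

/-- Prescribing |J| blocks prescribes |J|m ≤ N/10 values of the polynomial at distinct points, and
the Lagrange interpolant has degree less than |J|m. -/
theorem exists_mem_nullCode {s : ℕ} (hs : 1 ≤ s) (γ : (CodeField s)ˣ)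
    (hγ : ∀ u : (CodeField s)ˣ, u ∈ Subgroup.zpowers γ) (a : CodeField s) (ha : a = 0 ∨ a = 1)
    (J : Finset (Fin (codeLength s))) (hJ : 10 * J.card ≤ codeLength s)
    (v : Fin (codeLength s) → Alphabet s) :
    ∃ c ∈ nullCodeGroup s a γ, ∀ j ∈ J, c j = v j := by
  classical
  set pt : Fin (codeLength s * foldSize s) → CodeField s := fun i =>
    if (i : ℕ) = 0 then a else (γ : CodeField s) ^ (i : ℕ) with hpt
  have hpti : Function.Injective pt := evaluationPoint_injective hs γ hγ a ha
  let S : Finset (Fin (codeLength s) × Fin (foldSize s)) := J ×ˢ Finset.univ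
  let node : Fin (codeLength s) × Fin (foldSize s) → CodeField s := fun p => pt (finProdFinEquiv p)
  have hnode : Set.InjOn node S := (hpti.comp finProdFinEquiv.injective).injOn
  set p := Lagrange.interpolate S node (fun q => v q.1 q.2) with hp
  have hdeg : p.natDegree ≤ codeLength s * foldSize s / 10 := by
    refine Polynomial.natDegree_le_of_degree_le ?_
    refine (Lagrange.degree_interpolate_lt _ hnode).le.trans ?_
    have : S.card ≤ codeLength s * foldSize s / 10 := by
      rw [Finset.card_product, Finset.card_univ, Fintype.card_fin,
            Nat.le_div_iff_mul_le (by norm_num)]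
      calc _ = 10 * J.card * foldSize s := by ring
        _ ≤ _ := Nat.mul_le_mul_right _ hJ
    exact_mod_cast this
  refine ⟨fun j l => p.eval (pt (finProdFinEquiv (j, l))), ⟨p, hdeg, fun i => ?_⟩, fun j hj => ?_⟩
  · simp only [Prod.mk.eta, Equiv.apply_symm_apply]
    rfl
  · ext l
    exact Lagrange.eval_interpolate_at_node (s := S) (v := node) (fun q => v q.1 q.2) hnode
      (i := (j, l)) (Finset.mem_product.2 ⟨hj, Finset.mem_univ _⟩)

/-- The folded code tells apart the characters of weight at most `n / 20`. -/
theorem sum_nullCodeGroup_eq_zero {s : ℕ} (hs : 1 ≤ s) (γ : (CodeField s)ˣ)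
    (hγ : ∀ u : (CodeField s)ˣ, u ∈ Subgroup.zpowers γ) (a : CodeField s) (ha : a = 0 ∨ a = 1)
    [Fintype (Alphabet s)] [DecidableEq (Alphabet s)] [Fintype (nullCodeGroup s a γ)]
    (e e' : Fin (codeLength s) → AddChar (Alphabet s) ℂ)
    (he : 20 * charWeight e ≤ Fintype.card (Fin (codeLength s)))
    (he' : 20 * charWeight e' ≤ Fintype.card (Fin (codeLength s))) (hne : e ≠ e') :
    ∑ x : nullCodeGroup s a γ, star (piChar e x) * piChar e' x = 0 := by
  classical
  refine sum_star_piChar_mul_eq_zero e e' hne fun v => ?_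
  obtain ⟨c, hc, hcv⟩ := exists_mem_nullCode hs γ hγ a ha
    (Finset.univ.filter fun j => e j ≠ e' j) (by
      -- The two supports together have at most n/20 + n/20 = n/10 elements, exactly the
      -- interpolation capacity of the code.
      have hsub : (Finset.univ.filter fun j => e j ≠ e' j) ⊆
          (Finset.univ.filter fun j => e j ≠ 0) ∪ (Finset.univ.filter fun j => e' j ≠ 0) := by
        intro j
        simp only [Finset.mem_filter, Finset.mem_univ, true_and, Finset.mem_union]
        intro h
        by_contra! h'
        exact h (h'.1.trans h'.2.symm)
      have h1 := (Finset.card_le_card hsub).trans (Finset.card_union_le _ _)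
      simp only [Fintype.card_fin] at he he'
      have h2 : (Finset.univ.filter fun j => e j ≠ 0).card = charWeight e := by
        unfold charWeight
        congr
      have h3 : (Finset.univ.filter fun j => e' j ≠ 0).card = charWeight e' := by
        unfold charWeight
        congr
      omega) v
  exact ⟨c, hc, fun j hj => hcv j (by simpa using hj)⟩

end Code

/-! ### The measurement for one instance and one key -/

section Instance

open Matrix Kronecker

set_option linter.unusedSectionVars false

theorem isometry_submatrix_rows {Ω Ω' V : Type} [Fintype Ω] [Fintype Ω'] [DecidableEq V]
    {J : Matrix Ω V ℂ} (hJ : Jᴴ * J = 1) (e : Ω' ≃ Ω) :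
    (J.submatrix e id)ᴴ * J.submatrix e id = 1 := by
  rw [isometry_iff] at hJ ⊢
  intro u v
  rw [← hJ u v]
  exact Equiv.sum_comp e (fun ω => star (J ω u) * J ω v)

theorem isometry_one_kronecker {G Ω V : Type} [Fintype G] [DecidableEq G] [Fintype Ω] [Fintype V]
    [DecidableEq V] {J : Matrix Ω V ℂ} (hJ : Jᴴ * J = 1) :
    ((1 : Matrix G G ℂ) ⊗ₖ J)ᴴ * ((1 : Matrix G G ℂ) ⊗ₖ J) = 1 := by
  rw [conjTranspose_kronecker, ← mul_kronecker_mul, hJ, conjTranspose_one, Matrix.one_mul,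
    one_kronecker_one]

theorem one_sub_sum_le_prod {ι : Type} (S : Finset ι) (g : ι → ℝ) (h0 : ∀ i, 0 ≤ g i)
    (h1 : ∀ i, g i ≤ 1) : 1 - ∑ i ∈ S, (1 - g i) ≤ ∏ i ∈ S, g i := by
  classical
  induction S using Finset.induction_on with
  | empty => simp
  | insert i S hi ih =>
    rw [Finset.sum_insert hi, Finset.prod_insert hi]
    have hp : ∏ i ∈ S, g i ≤ 1 := Finset.prod_le_one (fun i _ => h0 i) (fun i _ => h1 i)
    nlinarith [h0 i, h1 i]

variable {A : Type} [Fintype A] [DecidableEq A]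

/-- Keep the symbols that pass the test against the hash function `h` and erase the second
register. -/
noncomputable def acceptMatrix (h : A → Fin 6 → Bool) : Matrix A (A × (Fin 6 → Bool)) ℂ :=
  Matrix.of fun a p => if p.1 = a ∧ andXor p.2 (h a) = false then (√63 : ℂ)⁻¹ else 0

/-- The uniform superposition of the graph of a function. -/
noncomputable def graphState (H : A → Fin 6 → Bool) (p : A × (Fin 6 → Bool)) : ℂ :=
  if p.2 = H p.1 then (√(Fintype.card A) : ℂ)⁻¹ else 0

/-- The indicator of the symbols that pass the test. -/
noncomputable def passIndicator (H h : A → Fin 6 → Bool) (a : A) : ℝ :=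
  if andXor (H a) (h a) = false then 1 else 0

/-- Distinct rows have disjoint supports, and each row has exactly 63 nonzero entries, since only
one of the 64 strings fails the test against `h a`. This fixes the scalar √63. -/
theorem acceptMatrix_mul_conjTranspose (h : A → Fin 6 → Bool) :
    acceptMatrix h * (acceptMatrix h)ᴴ = 1 := by
  have h63 : (√63 : ℂ) * (√63 : ℂ) = 63 := by
    rw [← Complex.ofReal_mul, Real.mul_self_sqrt (by norm_num)]
    norm_num
  ext a b
  rw [mul_apply, one_apply, Fintype.sum_prod_type, Finset.sum_eq_single a]
  · by_cases hab : a = b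
    · subst hab
      have h1 : ∀ v : Fin 6 → Bool, acceptMatrix h a (a, v) * (acceptMatrix h)ᴴ (a, v) a =
          ((if andXor (h a) v = false then (1 : ℝ) else 0 : ℝ) : ℂ) * (63 : ℂ)⁻¹ := fun v => by
        rw [andXor_comm (h a), ← h63]
        by_cases hv : andXor v (h a) = false
        · simp [acceptMatrix, hv]
        · simp [acceptMatrix, hv]
      simp_rw [h1]
      rw [← Finset.sum_mul, ← Complex.ofReal_sum, sum_andXor]
      simp
    · rw [if_neg hab]
      refine Finset.sum_eq_zero fun v _ => ?_
      simp [acceptMatrix, hab]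
  · intro c _ hc
    refine Finset.sum_eq_zero fun v _ => ?_
    simp [acceptMatrix, hc]
  · simp

/-- In the graph state the second register is determined by the first, so only the term `H a`
survives and erasing that register leaves a coherent superposition. -/
theorem acceptMatrix_mulVec_graphState (H h : A → Fin 6 → Bool) (a : A) :
    (acceptMatrix h *ᵥ graphState H) a =
      ((√63 * √(Fintype.card A) : ℝ) : ℂ)⁻¹ * (passIndicator H h a : ℂ) := by
  simp only [mulVec, dotProduct]
  rw [Fintype.sum_prod_type, Finset.sum_eq_single a, Finset.sum_eq_single (H a)]
  · simp [acceptMatrix, graphState, passIndicator]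
    split_ifs <;> simp [mul_comm]
  · intro v _ hv
    simp [graphState, hv]
  · simp
  · intro c _ hc
    refine Finset.sum_eq_zero fun v _ => ?_
    simp [acceptMatrix, hc]
  · simp

theorem sum_norm_sq_graphState [Nonempty A] (H : A → Fin 6 → Bool) :
    ∑ p, ‖graphState H p‖ ^ 2 = 1 := by
  have hA : (Fintype.card A : ℝ) ≠ 0 := Nat.cast_ne_zero.2 Fintype.card_ne_zero
  rw [Fintype.sum_prod_type]
  have h1 : ∀ a, ∑ v, ‖graphState H (a, v)‖ ^ 2 = (Fintype.card A : ℝ)⁻¹ := fun a => by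
    rw [Finset.sum_eq_single (H a)]
    · simp [graphState, abs_of_nonneg]
    · intro v _ hv
      simp [graphState, hv]
    · simp
  simp [h1, hA]

theorem passIndicator_sq (H h : A → Fin 6 → Bool) (a : A) :
    passIndicator H h a ^ 2 = passIndicator H h a := by
  unfold passIndicator
  split_ifs <;> simp

theorem passIndicator_le_one (H h : A → Fin 6 → Bool) (a : A) : passIndicator H h a ≤ 1 := by
  unfold passIndicator
  split_ifs <;> simp

theorem sum_norm_sq_acceptMatrix_mulVec (H h : A → Fin 6 → Bool) :
    ∑ a, ‖(acceptMatrix h *ᵥ graphState H) a‖ ^ 2 =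
      (∑ a, passIndicator H h a) / (63 * Fintype.card A) := by
  rw [Finset.sum_div]
  refine Finset.sum_congr rfl fun a _ => ?_
  rw [acceptMatrix_mulVec_graphState, norm_mul, norm_inv, Complex.norm_real, Complex.norm_real,
    mul_pow, inv_pow, Real.norm_eq_abs, Real.norm_eq_abs, sq_abs, sq_abs, passIndicator_sq,
    mul_pow, Real.sq_sqrt (by norm_num), Real.sq_sqrt (Nat.cast_nonneg _)]
  ring

variable {ι : Type} [Fintype ι] [DecidableEq ι] [AddCommGroup A]

open Classical in
-- The first factor is the probability that every coordinate obtains a successful copy. Given this,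
-- the state is `F` up to normalisation by its weight ∏ S_j, and the second factor is the bound from
-- `le_sum_decode`. Positivity of the sums makes the normalisation meaningful.
theorem exists_instance_isometry (C : AddSubgroup (ι → A)) [Fintype C]
    (good : (ι → AddChar A ℂ) → Prop) [DecidablePred good]
    (hgood : ∀ e e', good e → good e' → e ≠ e' →
      ∑ x : C, star (piChar e x) * piChar e' x = 0)
    (h : ι → A → Fin 6 → Bool) (T : ℕ) :
    ∃ (Ω : Type) (_ : Fintype Ω) (J : Matrix Ω (ι → Fin T → A × (Fin 6 → Bool)) ℂ)
      (out : Ω → ι → A), Jᴴ * J = 1 ∧ ∀ H : ι → A → Fin 6 → Bool,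
      (∀ j, 0 < ∑ a, passIndicator (H j) (h j) a) →
      (∏ j, (1 - (1 - (∑ a, passIndicator (H j) (h j) a) / (63 * Fintype.card A)) ^ T)) *
        (1 - decodeDefect C good (fun x => ∏ j, (passIndicator (H j) (h j) (x j) : ℂ)) /
          ∏ j, ∑ a, passIndicator (H j) (h j) a) ≤
      ∑ ω, if out ω ∈ C ∧ ∀ j, andXor (H j (out ω j)) (h j (out ω j)) = false then
        ‖(J *ᵥ fun u => ∏ j, ∏ t, graphState (H j) (u j t)) ω‖ ^ 2 else 0 := by
  have hrep := fun j => exists_isometry_first_success (acceptMatrix (h j))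
    (acceptMatrix_mul_conjTranspose (h j)) T
  choose G hG acc Jc hJc hψ using hrep
  let e : (∀ j, G j) × (ι → A) ≃ ∀ j, G j × A :=
    { toFun := fun p j => (p.1 j, p.2 j)
      invFun := fun q => (fun j => (q j).1, fun j => (q j).2)
      left_inv := fun _ => rfl
      right_inv := fun _ => rfl }
  set L := decodeMatrix C good * fourierMatrix ι A with hL
  have isoL : Lᴴ * L = 1 := isometry_mul (isometry_decodeMatrix hgood) isometry_fourierMatrix
  let J := ((1 : Matrix (∀ j, G j) (∀ j, G j) ℂ) ⊗ₖ L) * (piMatrix Jc).submatrix e id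
  refine ⟨(∀ j, G j) × (C ⊕ (ι → AddChar A ℂ)), inferInstance, J,
    -- The zero word is an arbitrary output for uncorrected errors. Any success it brings is dropped
    -- from the lower bound.
    fun ω => Sum.elim (fun x : C => (x : ι → A)) (fun _ => 0) ω.2,
    isometry_mul (isometry_one_kronecker isoL)
      (isometry_submatrix_rows (isometry_piMatrix hJc) e), fun H hpos => ?_⟩
  have hψ' := fun j => hψ j (graphState (H j)) (sum_norm_sq_graphState (H j))
  choose c hc hcs using hψ'
  set S : ι → ℝ := fun j => ∑ a, passIndicator (H j) (h j) a with hS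
  set F : (ι → A) → ℂ := fun x => ∏ j, (passIndicator (H j) (h j) (x j) : ℂ) with hF
  set κ : ℝ := √63 * √(Fintype.card A) with hκ
  have hκ2 : κ ^ 2 = 63 * Fintype.card A := by
    rw [hκ, mul_pow, Real.sq_sqrt (by norm_num), Real.sq_sqrt (Nat.cast_nonneg _)]
  have hA : (0 : ℝ) < Fintype.card A := Nat.cast_pos.2 Fintype.card_pos
  -- For fixed successful garbage `g` the registers hold a scalar multiple of `F`, on which `L` acts
  -- by linearity.
  have hamp : ∀ g : ∀ j, G j, (∀ j, acc j (g j) = true) → ∀ ω,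
      (J *ᵥ fun u => ∏ j, ∏ t, graphState (H j) (u j t)) (g, ω) =
        (∏ j, c j (g j)) * ((κ : ℂ)⁻¹ ^ Fintype.card ι * (L *ᵥ F) ω) := fun g hg ω => by
    have h1 : ∀ x : ι → A, ((piMatrix Jc).submatrix e id *ᵥ
        fun u => ∏ j, ∏ t, graphState (H j) (u j t)) (g, x) =
        (∏ j, c j (g j)) * ((κ : ℂ)⁻¹ ^ Fintype.card ι * F x) := fun x => by
      have := piMatrix_mulVec Jc (fun j u => ∏ t, graphState (H j) (u t)) (e (g, x))
      refine Eq.trans this ?_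
      have h2 : ∀ j, (Jc j *ᵥ fun u => ∏ t, graphState (H j) (u t)) (e (g, x) j) =
          c j (g j) * ((κ : ℂ)⁻¹ * (passIndicator (H j) (h j) (x j) : ℂ)) := fun j => by
        rw [← acceptMatrix_mulVec_graphState]
        exact hc j (g j) (hg j) (x j)
      simp_rw [h2, Finset.prod_mul_distrib, Finset.prod_const, Finset.card_univ]
      rfl
    rw [← mulVec_mulVec]
    simp only [mulVec, dotProduct] at h1 ⊢
    rw [Fintype.sum_prod_type, Finset.sum_eq_single g]
    · simp only [h1, kroneckerMap_apply, one_apply_eq, one_mul, Finset.mul_sum]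
      refine Finset.sum_congr rfl fun x _ => ?_
      ring
    · intro g' _ hg'
      refine Finset.sum_eq_zero fun x _ => ?_
      simp [kroneckerMap_apply, one_apply_ne (Ne.symm hg')]
    · simp
  have hdec := le_sum_decode hgood F
  rw [← hL] at hdec
  have hFS : ∑ x, ‖F x‖ ^ 2 = ∏ j, S j := by
    simp only [hF, norm_prod, ← Finset.prod_pow, Complex.norm_real, Real.norm_eq_abs, sq_abs,
      passIndicator_sq]
    exact sum_prod_pi (fun j a => passIndicator (H j) (h j) a)
  rw [hFS] at hdec
  have hprod : (∏ j, ∑ g, if acc j g = true then ‖c j g‖ ^ 2 else 0) * ∏ j, S j =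
      (∏ j, (1 - (1 - S j / (63 * Fintype.card A)) ^ T)) *
          (63 * Fintype.card A) ^ Fintype.card ι := by
    have : ∀ j, (∑ g, if acc j g = true then ‖c j g‖ ^ 2 else 0) * S j =
        (1 - (1 - S j / (63 * Fintype.card A)) ^ T) * (63 * Fintype.card A) := fun j => by
      have := hcs j
      rw [sum_norm_sq_acceptMatrix_mulVec] at this
      rw [← this]
      field_simp
      rfl
    rw [← Finset.prod_mul_distrib, Finset.prod_congr rfl fun j _ => this j,
      Finset.prod_mul_distrib, Finset.prod_const, Finset.card_univ]
  have hSpos : 0 < ∏ j, S j := Finset.prod_pos fun j _ => hpos j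
  set Γ := ∏ j, ∑ g, if acc j g = true then ‖c j g‖ ^ 2 else 0 with hΓ
  have hΓ0 : 0 ≤ Γ := Finset.prod_nonneg fun j _ => Finset.sum_nonneg fun g _ => by
    split_ifs <;> positivity
  calc _ = Γ * ((63 * Fintype.card A : ℝ) ^ Fintype.card ι)⁻¹ *
        (∏ j, S j - decodeDefect C good F) := by
        have : (∏ j, (1 - (1 - S j / (63 * Fintype.card A)) ^ T)) =
            Γ * (∏ j, S j) * ((63 * Fintype.card A : ℝ) ^ Fintype.card ι)⁻¹ := by
          rw [hprod]
          field_simp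
        rw [this]
        field_simp
    _ ≤ Γ * ((63 * Fintype.card A : ℝ) ^ Fintype.card ι)⁻¹ *
        ∑ x : C, if F x = 0 then 0 else ‖(L *ᵥ F) (Sum.inl x)‖ ^ 2 := by
        gcongr
    _ = ∑ g : ∀ j, G j, ∑ x : C, (∏ j, if acc j (g j) = true then ‖c j (g j)‖ ^ 2 else 0) *
        (((63 * Fintype.card A : ℝ) ^ Fintype.card ι)⁻¹ *
          if F x = 0 then 0 else ‖(L *ᵥ F) (Sum.inl x)‖ ^ 2) := by
        rw [hΓ, ← sum_prod_pi (fun j g => if acc j g = true then ‖c j g‖ ^ 2 else 0),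
          mul_assoc, Finset.mul_sum, Finset.sum_mul_sum]
    _ ≤ _ := by
        rw [Fintype.sum_prod_type]
        refine Finset.sum_le_sum fun g _ => ?_
        rw [Fintype.sum_sum_type]
        refine le_trans (Finset.sum_le_sum fun x _ => ?_)
          (le_add_of_nonneg_right (Finset.sum_nonneg fun e _ => by split_ifs <;> positivity))
        have hnn : (0 : ℝ) ≤ if (x : ι → A) ∈ C ∧
            ∀ j, andXor (H j ((x : ι → A) j)) (h j ((x : ι → A) j)) = false then
            ‖(J *ᵥ fun u => ∏ j, ∏ t, graphState (H j) (u j t)) (g, Sum.inl x)‖ ^ 2 else 0 := by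
          split_ifs <;> positivity
        by_cases hg : ∀ j, acc j (g j) = true
        · by_cases hx : F x = 0
          · rw [if_pos hx, mul_zero, mul_zero]
            exact hnn
          · have hx' : ∀ j, andXor (H j ((x : ι → A) j)) (h j ((x : ι → A) j)) = false := by
              intro j
              by_contra hj
              refine hx (Finset.prod_eq_zero (Finset.mem_univ j) ?_)
              simp [passIndicator, hj]
            refine le_trans (le_of_eq ?_) (le_of_eq (if_pos ⟨x.2, hx'⟩).symm)
            have hκn : ‖(κ : ℂ)⁻¹ ^ Fintype.card ι‖ ^ 2 =
                ((63 * Fintype.card A : ℝ) ^ Fintype.card ι)⁻¹ := by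
              rw [norm_pow, norm_inv, Complex.norm_real, Real.norm_eq_abs, ← pow_mul,
                mul_comm (Fintype.card ι), pow_mul, inv_pow, sq_abs, hκ2, inv_pow]
            rw [if_neg hx, hamp g hg, Finset.prod_congr rfl fun j _ => if_pos (hg j), norm_mul,
              norm_mul, ← hκn, norm_prod, mul_pow, mul_pow, Finset.prod_pow]
        · push Not at hg
          obtain ⟨j, hj⟩ := hg
          rw [Finset.prod_eq_zero (Finset.mem_univ j) (if_neg hj), zero_mul]
          exact hnn

end Instance

/-! ### Combining keys and instances -/

section Assembly

open Matrix

/-- The failure probability of one instance in terms of the defect and of the densities. -/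
theorem one_sub_le_failure {ι : Type} [Fintype ι] (S : ι → ℝ) {a : ℝ} (ha : 0 < a)
    (hS : ∀ j, S j ≤ a) {D s : ℝ} (hD : 0 ≤ D) (hs0 : 0 ≤ s) (T : ℕ)
    (hs : (∀ j, 0 < S j) →
      (∏ j, (1 - (1 - S j / (63 * a)) ^ T)) * (1 - D / ∏ j, S j) ≤ s) :
    1 - s ≤ Fintype.card ι * (99 / 100) ^ T + D / (39 / 40 * a) ^ Fintype.card ι +
      ∑ j, (S j - 63 / 64 * a) ^ 2 / (3 / 320 * a) ^ 2 := by
  have hD' : 0 ≤ D / (39 / 40 * a) ^ Fintype.card ι := by positivity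
  have hC' : ∀ j, 0 ≤ (S j - 63 / 64 * a) ^ 2 / (3 / 320 * a) ^ 2 := fun j => by positivity
  -- If every density is at least 39/40, the first two terms bound the failure. Otherwise some
  -- density deviates from 63/64 by more than 63/64 - 39/40 = 3/320, and its Chebyshev term alone is
  -- at least 1.
  by_cases h : ∀ j, 39 / 40 * a ≤ S j
  · have hpos : ∀ j, 0 < S j := fun j => lt_of_lt_of_le (by positivity) (h j)
    have hb0 : ∀ j, 0 ≤ 1 - S j / (63 * a) := fun j => by
      rw [sub_nonneg, div_le_one (by positivity)]
      linarith [hS j]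
    have hb1 : ∀ j, 1 - S j / (63 * a) ≤ 99 / 100 := fun j => by
      -- One copy succeeds with probability at least (39/40)/63, which is above 1/100.
      have : 1 / 100 ≤ S j / (63 * a) := by
        rw [div_le_div_iff₀ (by norm_num) (by positivity)]
        nlinarith [h j]
      linarith
    have hb2 : ∀ j, (1 - S j / (63 * a)) ^ T ≤ 1 := fun j =>
      pow_le_one₀ (hb0 j) (by linarith [hb1 j])
    have hprod := one_sub_sum_le_prod Finset.univ (fun j => 1 - (1 - S j / (63 * a)) ^ T)
      (fun j => by linarith [hb2 j]) (fun j => by linarith [pow_nonneg (hb0 j) T])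
    have hprod1 : ∏ j, (1 - (1 - S j / (63 * a)) ^ T) ≤ 1 :=
      Finset.prod_le_one (fun j _ => by linarith [hb2 j])
        (fun j _ => by linarith [pow_nonneg (hb0 j) T])
    have hsum : ∑ j, (1 - (1 - (1 - S j / (63 * a)) ^ T)) ≤ Fintype.card ι * (99 / 100) ^ T := by
      calc _ ≤ ∑ _j : ι, ((99 : ℝ) / 100) ^ T := Finset.sum_le_sum fun j _ => by
            rw [sub_sub_cancel]
            exact pow_le_pow_left₀ (hb0 j) (hb1 j) T
        _ = _ := by simp
    have hDle : D / ∏ j, S j ≤ D / (39 / 40 * a) ^ Fintype.card ι := by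
      apply div_le_div_of_nonneg_left hD (by positivity)
      calc _ = ∏ _j : ι, (39 / 40 * a) := by simp
        _ ≤ _ := Finset.prod_le_prod (fun _ _ => by positivity) (fun j _ => h j)
    have hD0 : 0 ≤ D / ∏ j, S j := div_nonneg hD (Finset.prod_nonneg fun j _ => (hpos j).le)
    have := hs hpos
    have := Finset.sum_nonneg fun j (_ : j ∈ Finset.univ) => hC' j
    nlinarith
  · push Not at h
    obtain ⟨j, hj⟩ := h
    have h1 : 1 ≤ (S j - 63 / 64 * a) ^ 2 / (3 / 320 * a) ^ 2 := by
      rw [one_le_div (by positivity)]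
      nlinarith
    have h2 := Finset.single_le_sum (fun j _ => hC' j) (Finset.mem_univ j)
    have h3 : 0 ≤ (Fintype.card ι : ℝ) * (99 / 100) ^ T := by positivity
    linarith

open Classical in
/-- Measure independent instances with a random key. -/
theorem exists_keyed_isometry {K I V W : Type} [Fintype K] [Nonempty K] [Fintype I] [Fintype V]
    [DecidableEq I] [DecidableEq V]
    (Ω : K → Type) [∀ k, Fintype (Ω k)] (J : ∀ k, Matrix (Ω k) V ℂ) (out : ∀ k, Ω k → W)
    (hJ : ∀ k, (J k)ᴴ * J k = 1) :
    ∃ (Ω' : Type) (_ : Fintype Ω') (J' : Matrix Ω' (I → V) ℂ) (out' : Ω' → K × (I → W)),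
      J'ᴴ * J' = 1 ∧ ∀ (ok : K → I → W → Prop) (ψ : I → V → ℂ),
      (∑ ω, if ∀ i, ok (out' ω).1 i ((out' ω).2 i) then
        ‖(J' *ᵥ fun u => ∏ i, ψ i (u i)) ω‖ ^ 2 else 0) =
      (∑ k, ∏ i, ∑ ω, if ok k i (out k ω) then ‖(J k *ᵥ ψ i) ω‖ ^ 2 else 0) /
        Fintype.card K := by
  have hK0 : (Fintype.card K : ℝ) ≠ 0 := Nat.cast_ne_zero.2 Fintype.card_ne_zero
  have hKC : (Fintype.card K : ℂ) ≠ 0 := Nat.cast_ne_zero.2 Fintype.card_ne_zero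
  -- One block of rows per key, scaled by 1/√|K|: reading off the block yields a uniform key,
  -- whatever the state.
  let J' : Matrix (Σ k, I → Ω k) (I → V) ℂ := Matrix.of fun ω u =>
    piMatrix (fun _ : I => J ω.1) ω.2 u / (√(Fintype.card K) : ℂ)
  refine ⟨Σ k, I → Ω k, inferInstance, J', fun ω => (ω.1, fun i => out ω.1 (ω.2 i)), ?_, ?_⟩
  · rw [isometry_iff]
    intro u v
    rw [Fintype.sum_sigma]
    have h : ∀ k, ∑ ω : I → Ω k, star (J' ⟨k, ω⟩ u) * J' ⟨k, ω⟩ v =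
        (if u = v then 1 else 0) / Fintype.card K := fun k => by
      rw [← (isometry_iff _).1 (isometry_piMatrix (fun _ : I => hJ k)) u v, Finset.sum_div]
      refine Finset.sum_congr rfl fun ω _ => ?_
      simp only [J', of_apply]
      rw [← sqrt_card_mul_self, star_div₀,
        show star (√(Fintype.card K) : ℂ) = √(Fintype.card K) from Complex.conj_ofReal _,
        div_mul_div_comm]
    simp_rw [h]
    simp
    field_simp
  · intro ok ψ
    rw [Fintype.sum_sigma, Finset.sum_div]
    refine Finset.sum_congr rfl fun k _ => ?_
    rw [← sum_prod_pi (fun i (ω : Ω k) => if ok k i (out k ω) then ‖(J k *ᵥ ψ i) ω‖ ^ 2 else 0),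
      Finset.sum_div]
    refine Finset.sum_congr rfl fun ω _ => ?_
    have h1 : (J' *ᵥ fun u => ∏ i, ψ i (u i)) ⟨k, ω⟩ =
        (∏ i, (J k *ᵥ ψ i) (ω i)) / (√(Fintype.card K) : ℂ) := by
      rw [← piMatrix_mulVec (fun _ : I => J k) ψ ω]
      simp only [mulVec, dotProduct, J', of_apply, Finset.sum_div]
      refine Finset.sum_congr rfl fun u _ => ?_
      ring
    rw [h1, norm_div, div_pow, Complex.norm_real, Real.norm_eq_abs, sq_abs,
      Real.sq_sqrt (Nat.cast_nonneg _), norm_prod, ← Finset.prod_pow]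
    by_cases hok : ∀ i, ok k i (out k (ω i))
    · rw [if_pos hok, Finset.prod_congr rfl fun i _ => if_pos (hok i)]
    · rw [if_neg hok]
      push Not at hok
      obtain ⟨i, hi⟩ := hok
      rw [Finset.prod_eq_zero (Finset.mem_univ i) (if_neg hi), zero_div]

theorem sum_norm_sq_prod_eq_one {I : Type} [Fintype I] [DecidableEq I] {V : I → Type}
    [∀ i, Fintype (V i)] (ψ : ∀ i, V i → ℂ) (h : ∀ i, ∑ v, ‖ψ i v‖ ^ 2 = 1) :
    ∑ u : ∀ i, V i, ‖∏ i, ψ i (u i)‖ ^ 2 = 1 := by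
  simp only [norm_prod, ← Finset.prod_pow]
  rw [sum_prod_pi (fun i v => ‖ψ i v‖ ^ 2)]
  simp [h]

theorem decodeDefect_nonneg {ι A : Type} [Fintype ι] [DecidableEq ι] [AddCommGroup A] [Fintype A]
    [DecidableEq A] (C : AddSubgroup (ι → A)) [Fintype C] (good : (ι → AddChar A ℂ) → Prop)
    [DecidablePred good] (F : (ι → A) → ℂ) : 0 ≤ decodeDefect C good F := by
  unfold decodeDefect
  refine add_nonneg (Finset.sum_nonneg fun e _ => ?_) (by positivity)
  split_ifs <;> positivity

/-! ### Qubits -/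

theorem card_alphabet {s : ℕ} (hs : 1 ≤ s) [Fintype (Alphabet s)] :
    Fintype.card (Alphabet s) = 2 ^ (2 * s * foldSize s) := by
  rw [← Nat.card_eq_fintype_card, Nat.card_fun, GaloisField.card 2 _ (by omega), Nat.card_fin,
    ← pow_mul]

/-- The number of qubits that hold one copy of the graph of a function. -/
def graphQubits (s : ℕ) : ℕ := 2 * s * foldSize s + 6

/-- The alphabet and the set of hash values have cardinality a power of two, so the registers fit
the qubits without padding. -/
theorem nonempty_qubits_equiv {s : ℕ} (hs : 1 ≤ s) (U : Type) [Fintype U] :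
    Nonempty ((Fin (graphQubits s * codeLength s * Fintype.card U * numInstances s) → Bool) ≃
      (Fin (numInstances s) → U → Fin (codeLength s) → Alphabet s × (Fin 6 → Bool))) := by
  classical
  let := Fintype.ofFinite (CodeField s)
  refine ⟨Fintype.equivOfCardEq ?_⟩
  simp only [Fintype.card_fun, Fintype.card_bool, Fintype.card_fin, Fintype.card_prod]
  have := card_alphabet hs
  simp only [Fintype.card_fun, Fintype.card_fin] at this
  rw [this, ← pow_add, ← pow_mul, ← pow_mul, ← pow_mul, graphQubits]
  ring_nf

/-- Join the registers of Alice and Bob. -/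
def joinEquiv (I : Type) (n : ℕ) (R : Type) :
    ((I → AliceIdx n → R) × (I → BobIdx n → R)) ≃ (I → Fin n → R) where
  toFun p i j := if h : (j : ℕ) < n / 2 then p.1 i ⟨j, h⟩ else p.2 i ⟨j, h⟩
  invFun q := (fun i j => q i j, fun i j => q i j)
  left_inv p := by
    refine Prod.ext (funext fun i => funext fun j => ?_) (funext fun i => funext fun j => ?_)
    · exact dif_pos j.2
    · exact dif_neg j.2
  right_inv q := by
    ext i j
    simp

theorem joinEquiv_apply_alice {I : Type} {n : ℕ} {R : Type}
    (p : (I → AliceIdx n → R) × (I → BobIdx n → R)) (i : I) (j : AliceIdx n) :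
    joinEquiv I n R p i j = p.1 i j := dif_pos j.2

theorem joinEquiv_apply_bob {I : Type} {n : ℕ} {R : Type}
    (p : (I → AliceIdx n → R) × (I → BobIdx n → R)) (i : I) (j : BobIdx n) :
    joinEquiv I n R p i j = p.2 i j := dif_neg j.2

theorem card_aliceIdx_add_card_bobIdx (n : ℕ) :
    Fintype.card (AliceIdx n) + Fintype.card (BobIdx n) = n := by
  rw [← Fintype.card_sum, Fintype.card_congr (Equiv.sumCompl _), Fintype.card_fin]

end Assembly

/-! ### The average failure probability -/

section Main

open Matrix

/-- With n copies per register the three terms average to at most n(99/100)^n, 2(99/100)^n and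
175n/|A|. As |A| ≥ 2^n and n ≥ 1, the total is at most 178n(99/100)^n. -/
theorem IsBernoulliFamily.sum_failure_le {ι A K : Type} [Fintype ι] [DecidableEq ι]
    [AddCommGroup A] [Fintype A] [DecidableEq A] [Fintype K] {f : K → ι × A → ℝ}
    (hf : IsBernoulliFamily f (63 / 64) (2 * Fintype.card ι)) (C : AddSubgroup (ι → A))
    [Fintype C] (hι : 1 ≤ Fintype.card ι) (hA : 2 ^ Fintype.card ι ≤ Fintype.card A) :
    ∑ k, (Fintype.card ι * (99 / 100) ^ Fintype.card ι +
      decodeDefect C (fun e => 20 * charWeight e ≤ Fintype.card ι)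
        (fun x => ∏ j, (f k (j, x j) : ℂ)) / (39 / 40 * Fintype.card A) ^ Fintype.card ι +
      ∑ j, (∑ a, f k (j, a) - 63 / 64 * Fintype.card A) ^ 2 / (3 / 320 * Fintype.card A) ^ 2) ≤
      Fintype.card K * (178 * Fintype.card ι * (99 / 100) ^ Fintype.card ι) := by
  set n := Fintype.card ι with hn
  have hA0 : (0 : ℝ) < Fintype.card A := Nat.cast_pos.2 Fintype.card_pos
  have hn1 : (1 : ℝ) ≤ n := by exact_mod_cast hι
  have hA' : (2 : ℝ) ^ n ≤ Fintype.card A := by exact_mod_cast hA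
  have hK0 : (0 : ℝ) ≤ Fintype.card K := Nat.cast_nonneg _
  rw [Finset.sum_add_distrib, Finset.sum_add_distrib, ← Finset.sum_div, hf.sum_decodeDefect,
    Finset.sum_comm]
  -- This uses 0.962 < (99/100)(39/40).
  have h1 : (∑ e : ι → AddChar A ℂ, if 20 * charWeight e ≤ n then 0
      else ∏ j, spectralWeight (63 / 64) (e j)) / (39 / 40 * Fintype.card A) ^ n ≤
      (99 / 100) ^ n := by
    rw [div_le_iff₀ (by positivity), ← mul_pow]
    refine sum_spectralWeight_tail_le.trans (pow_le_pow_left₀ (by positivity) ?_ n)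
    linarith
  have h2 : (1 : ℝ) / Fintype.card A ≤ (99 / 100) ^ n := by
    rw [div_le_iff₀ hA0]
    calc (1 : ℝ) ≤ (99 / 100 * 2) ^ n := one_le_pow₀ (by norm_num)
      _ = (99 / 100) ^ n * 2 ^ n := mul_pow _ _ _
      _ ≤ _ := by gcongr
  -- Here 175 is the variance 63/64 - (63/64)² divided by (3/320)².
  have h3 : (Fintype.card K : ℝ) * ((63 / 64 - (63 / 64) ^ 2) * Fintype.card A) /
      (3 / 320 * Fintype.card A) ^ 2 = Fintype.card K * (175 * (1 / Fintype.card A)) := by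
    field_simp
    ring
  have h5 : ∀ j, ∑ k, (∑ a, f k (j, a) - 63 / 64 * Fintype.card A) ^ 2 /
      (3 / 320 * Fintype.card A) ^ 2 =
      (Fintype.card K : ℝ) * (175 * (1 / Fintype.card A)) := fun j => by
    rw [← Finset.sum_div, hf.sum_sub_sq, h3]
  simp only [h5, Finset.sum_const, Finset.card_univ, nsmul_eq_mul, ← hn]
  rw [mul_left_comm (2 : ℝ), mul_div_assoc, mul_left_comm (n : ℝ) (Fintype.card K : ℝ),
    ← mul_add, ← mul_add]
  refine mul_le_mul_of_nonneg_left ?_ hK0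
  have h4 : (0 : ℝ) < (99 / 100) ^ n := by positivity
  rw [mul_div_assoc]
  nlinarith

theorem two_pow_codeLength_le_card_alphabet {s : ℕ} (hs : 1 ≤ s) [Fintype (Alphabet s)] :
    2 ^ codeLength s ≤ Fintype.card (Alphabet s) := by
  rw [card_alphabet hs]
  refine Nat.pow_le_pow_right (by norm_num) ?_
  unfold codeLength foldSize
  nlinarith [Nat.sub_le (2 ^ s) 1]

/-- The state that one player sends: one register for each instance and coordinate. -/
noncomputable def playerState {I U X V : Type} [Fintype I] [Fintype U] (φ : X → V → ℂ)
    (H : I → U → X) (u : I → U → V) : ℂ :=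
  ∏ i, ∏ j, φ (H i j) (u i j)

theorem sum_norm_sq_playerState {I U X V : Type} [Fintype I] [Fintype U] [Fintype V]
    [DecidableEq I] [DecidableEq U] {φ : X → V → ℂ} (hφ : ∀ x, ∑ v, ‖φ x v‖ ^ 2 = 1)
    (H : I → U → X) : ∑ u : I → U → V, ‖playerState φ H u‖ ^ 2 = 1 :=
  sum_norm_sq_prod_eq_one (fun i (u : U → V) => ∏ j, φ (H i j) (u j)) fun i =>
    sum_norm_sq_prod_eq_one (fun j => φ (H i j)) fun j => hφ (H i j)

/-- The inputs of both players. -/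
def joinInput {I X : Type} {n : ℕ} (HA : I → AliceIdx n → X) (HB : I → BobIdx n → X) (i : I)
    (j : Fin n) : X :=
  if h : (j : ℕ) < n / 2 then HA i ⟨j, h⟩ else HB i ⟨j, h⟩

theorem joinInput_alice {I X : Type} {n : ℕ} (HA : I → AliceIdx n → X) (HB : I → BobIdx n → X)
    (i : I) (j : AliceIdx n) : joinInput HA HB i j = HA i j := dif_pos j.2

theorem joinInput_bob {I X : Type} {n : ℕ} (HA : I → AliceIdx n → X) (HB : I → BobIdx n → X)
    (i : I) (j : BobIdx n) : joinInput HA HB i j = HB i j := dif_neg j.2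

/-- Each coordinate has its own register, so the product across the cut is the state a single player
holding all functions would send. -/
theorem playerState_mul_playerState {I X V : Type} [Fintype I] {n : ℕ} (φ : X → V → ℂ)
    (HA : I → AliceIdx n → X) (HB : I → BobIdx n → X)
    (u : (I → AliceIdx n → V) × (I → BobIdx n → V)) :
    playerState φ HA u.1 * playerState φ HB u.2 =
      playerState φ (joinInput HA HB) (joinEquiv I n V u) := by
  rw [playerState, playerState, ← Finset.prod_mul_distrib]
  refine Finset.prod_congr rfl fun i _ => ?_
  refine Eq.trans ?_ (Fintype.prod_subtype_mul_prod_subtype (fun j : Fin n => (j : ℕ) < n / 2)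
    (fun j => φ (joinInput HA HB i j) (joinEquiv I n V u i j)))
  congr 1
  · refine Finset.prod_congr rfl fun j _ => ?_
    rw [joinEquiv_apply_alice, joinInput_alice]
  · refine Finset.prod_congr rfl fun j _ => ?_
    rw [joinEquiv_apply_bob, joinInput_bob]

open Classical in
/-- The protocol in which both players send product states. -/
theorem exists_product_protocol {I X V O Ω : Type} [Fintype I] [Fintype V]
    [DecidableEq I] [DecidableEq V] [Fintype O] [Fintype Ω] {n : ℕ}
    (qa qb : ℕ) (eA : (Fin qa → Bool) ≃ (I → AliceIdx n → V))
    (eB : (Fin qb → Bool) ≃ (I → BobIdx n → V)) (φ : X → V → ℂ)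
    (hφ : ∀ x, ∑ v, ‖φ x v‖ ^ 2 = 1)
    (J : Matrix Ω (I → Fin n → V) ℂ) (hJ : Jᴴ * J = 1) (out : Ω → O) :
    ∃ Q : QSMPProtocol (I → AliceIdx n → X) (I → BobIdx n → X) O,
      Q.cost = qa + qb ∧ ∀ (S : _ → _ → O → Prop) HA HB, Q.successProb S HA HB =
        ∑ ω, if S HA HB (out ω) then ‖(J *ᵥ playerState φ (joinInput HA HB)) ω‖ ^ 2 else 0 := by
  obtain ⟨Q, hcost, hQ⟩ := exists_protocol_of_isometry (O := O) qa qb eA eB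
    (fun HA : I → AliceIdx n → X => playerState φ HA)
    (fun HB : I → BobIdx n → X => playerState φ HB)
    (sum_norm_sq_playerState hφ) (sum_norm_sq_playerState hφ)
    (J.submatrix id (joinEquiv I n V)) (isometry_submatrix_equiv hJ _) out
  refine ⟨Q, hcost, fun S HA HB => ?_⟩
  rw [hQ]
  refine Finset.sum_congr rfl fun ω _ => ?_
  have : (J.submatrix id (joinEquiv I n V) *ᵥ
      fun u => playerState φ HA u.1 * playerState φ HB u.2) ω =
      (J *ᵥ playerState φ (joinInput HA HB)) ω := by
    simp only [playerState_mul_playerState]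
    exact Equiv.sum_comp (joinEquiv I n V) (fun u => J ω u * playerState φ (joinInput HA HB) u)
  rw [this]

/-- The condition 2 ≤ n ensures 2n ≤ n², so that n²-wise independence covers the second moments of
`F`. -/
theorem exists_TBNC_protocol {s : ℕ} (hs : 1 ≤ s) (γ : (CodeField s)ˣ)
    (hγ : ∀ u : (CodeField s)ˣ, u ∈ Subgroup.zpowers γ) (a : CodeField s) (ha : a = 0 ∨ a = 1)
    (enc : Alphabet s × Fin (codeLength s) ↪ HashField s)
    (bits : HashField s ≃ (Fin (hashBits s) → Bool)) :
    ∃ Q : QSMPProtocol (AliceInput s) (BobInput s) (TBNCOutput s),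
      Q.cost = graphQubits s * codeLength s * codeLength s * numInstances s ∧
      ∀ HA HB, 0 ≤ Q.successProb (TBNC a (γ : CodeField s) enc bits) HA HB ∧
        (2 ≤ codeLength s → 1 - numInstances s * (178 * codeLength s * (99 / 100) ^ codeLength s) ≤
          Q.successProb (TBNC a (γ : CodeField s) enc bits) HA HB) := by
  classical
  let : Fintype (CodeField s) := Fintype.ofFinite _
  let : Fintype (HashField s) := Fintype.ofFinite _
  set C := nullCodeGroup s a (γ : CodeField s) with hC
  let : Fintype C := Fintype.ofFinite _
  have hgood := sum_nullCodeGroup_eq_zero hs γ hγ a ha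
  have hinst := fun k : HashKey s => exists_instance_isometry C
    (fun e => 20 * charWeight e ≤ Fintype.card (Fin (codeLength s))) hgood
    (fun j e => polyHash enc bits k e j) (codeLength s)
  choose Ω hΩ J out hJ hsucc using hinst
  obtain ⟨Ω', _, J', out', hJ', hsum⟩ :=
    exists_keyed_isometry (I := Fin (numInstances s)) Ω J out hJ
  obtain ⟨eA⟩ := nonempty_qubits_equiv hs (AliceIdx (codeLength s))
  obtain ⟨eB⟩ := nonempty_qubits_equiv hs (BobIdx (codeLength s))
  obtain ⟨Q, hcost, hQ⟩ := exists_product_protocol (O := TBNCOutput s) _ _ eA eB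
    (fun (h : Alphabet s → Fin 6 → Bool) (u : Fin (codeLength s) → Alphabet s × (Fin 6 → Bool)) =>
      ∏ t, graphState h (u t))
    (fun h => sum_norm_sq_prod_eq_one (fun _ => graphState h) fun _ => sum_norm_sq_graphState h)
    J' hJ' out'
  refine ⟨Q, ?_, fun HA HB => ?_⟩
  · rw [hcost, ← add_mul, ← mul_add, card_aliceIdx_add_card_bobIdx]
  · let H := joinInput HA HB
    have hHA : ∀ i (j : AliceIdx (codeLength s)), H i j = HA i j :=
      fun i j => joinInput_alice HA HB i j
    have hHB : ∀ i (j : BobIdx (codeLength s)), H i j = HB i j :=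
      fun i j => joinInput_bob HA HB i j
    let ψ : Fin (numInstances s) →
        (Fin (codeLength s) → Fin (codeLength s) → Alphabet s × (Fin 6 → Bool)) → ℂ := fun i u =>
      ∏ j, ∏ t, graphState (H i j) (u j t)
    let ok : HashKey s → Fin (numInstances s) → (Fin (codeLength s) → Alphabet s) → Prop :=
      fun k i x =>
      x ∈ C ∧ ∀ j, andXor (H i j (x j)) (polyHash enc bits k (x j) j) = false
    let p : HashKey s → Fin (numInstances s) → ℝ := fun k i =>
      ∑ ω, @ite ℝ (ok k i (out k ω)) (Classical.propDecidable _) (‖(J k *ᵥ ψ i) ω‖ ^ 2) 0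
    have hp0 : ∀ k i, 0 ≤ p k i := fun k i => Finset.sum_nonneg fun ω _ => by
      split_ifs <;> positivity
    have hψ : ∀ i, ∑ u, ‖ψ i u‖ ^ 2 = 1 := fun i =>
      sum_norm_sq_prod_eq_one (fun j (u : Fin (codeLength s) → Alphabet s × (Fin 6 → Bool)) =>
        ∏ t, graphState (H i j) (u t)) fun j =>
      sum_norm_sq_prod_eq_one (fun _ => graphState (H i j)) fun _ =>
        sum_norm_sq_graphState (H i j)
    have hp1 : ∀ k i, p k i ≤ 1 := fun k i => by
      rw [← hψ i, ← sum_norm_sq_mulVec (hJ k)]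
      refine Finset.sum_le_sum fun ω _ => ?_
      split_ifs
      · exact le_rfl
      · positivity
    have hrel : ∀ o : TBNCOutput s, TBNC a (γ : CodeField s) enc bits HA HB o ↔
        ∀ i, ok o.1 i (o.2 i) := fun o => by
      refine forall_congr' fun i => and_congr Iff.rfl
        ⟨fun h j => ?_, fun h => ⟨fun j => ?_, fun j => ?_⟩⟩
      · by_cases hj : (j : ℕ) < codeLength s / 2
        · have := h.1 ⟨j, hj⟩
          rwa [← hHA] at this
        · have := h.2 ⟨j, hj⟩
          rwa [← hHB] at this
      · rw [← hHA]
        exact h j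
      · rw [← hHB]
        exact h j
    have hprob : Q.successProb (TBNC a (γ : CodeField s) enc bits) HA HB =
        (∑ k, ∏ i, p k i) / Fintype.card (HashKey s) := by
      rw [hQ]
      refine Eq.trans (Finset.sum_congr rfl fun ω _ => ?_) (hsum ok ψ)
      by_cases h : ∀ i, ok (out' ω).1 i ((out' ω).2 i)
      · rw [if_pos ((hrel _).2 h), if_pos h]
        rfl
      · rw [if_neg (mt (hrel _).1 h), if_neg h]
    rw [hprob]
    have hK : (0 : ℝ) < Fintype.card (HashKey s) := Nat.cast_pos.2 Fintype.card_pos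
    refine ⟨div_nonneg (Finset.sum_nonneg fun k _ => Finset.prod_nonneg fun i _ => hp0 k i) hK.le,
      fun hn2 => ?_⟩
    have hfail : ∀ i, ∑ k, (1 - p k i) ≤
        Fintype.card (HashKey s) * (178 * codeLength s * (99 / 100) ^ codeLength s) := fun i => by
      have hf := (isBernoulliFamily_polyHash hs enc bits (H i)).mono
        (show 2 * Fintype.card (Fin (codeLength s)) ≤ codeLength s ^ 2 by
          rw [Fintype.card_fin]
          nlinarith)
      have := hf.sum_failure_le C (by rw [Fintype.card_fin]; omega)
        (by rw [Fintype.card_fin]; exact two_pow_codeLength_le_card_alphabet hs)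
      rw [Fintype.card_fin] at this
      refine le_trans (Finset.sum_le_sum fun k _ => ?_) this
      have hA0 : (0 : ℝ) < Fintype.card (Alphabet s) := Nat.cast_pos.2 Fintype.card_pos
      have := one_sub_le_failure
        (fun j => ∑ x, passIndicator (H i j) (fun e => polyHash enc bits k e j) x) hA0
        (fun j => (Finset.sum_le_sum fun x _ => passIndicator_le_one _ _ x).trans (by simp))
        (decodeDefect_nonneg C (fun e => 20 * charWeight e ≤ Fintype.card (Fin (codeLength s)))
          (fun x => ∏ j, (passIndicator (H i j) (fun e => polyHash enc bits k e j) (x j) : ℂ)))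
        (hp0 k i) (codeLength s) fun hpos => (hsucc k (H i) hpos).trans_eq
          (Finset.sum_congr rfl fun ω _ => by congr)
      rw [Fintype.card_fin] at this
      exact this
    rw [le_div_iff₀ hK]
    -- The instances share the key, so the union bound is taken for each fixed key and the sums over
    -- keys and instances are exchanged afterwards.
    calc _ = (Fintype.card (HashKey s) : ℝ) - ∑ _i : Fin (numInstances s),
          (Fintype.card (HashKey s) : ℝ) *
            (178 * codeLength s * (99 / 100) ^ codeLength s) := by
          rw [Finset.sum_const, Finset.card_univ, Fintype.card_fin, nsmul_eq_mul]
          generalize (Fintype.card (HashKey s) : ℝ) = K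
          ring
      _ ≤ (Fintype.card (HashKey s) : ℝ) - ∑ i, ∑ k, (1 - p k i) :=
          sub_le_sub_left (Finset.sum_le_sum fun i _ => hfail i) _
      _ = ∑ k, (1 - ∑ i, (1 - p k i)) := by
          rw [Finset.sum_sub_distrib, Finset.sum_comm]
          simp
      _ ≤ _ := Finset.sum_le_sum fun k _ => one_sub_sum_le_prod _ _ (hp0 k) (hp1 k)

/-! ### Polynomial bounds on the parameters and negligible error -/

theorem exponent_le_codeLength (s : ℕ) : s ≤ codeLength s := by
  have : s < 2 ^ s := Nat.lt_two_pow_self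
  unfold codeLength
  omega

theorem foldSize_eq (s : ℕ) : foldSize s = codeLength s + 2 := by
  have : 0 < 2 ^ s := by positivity
  unfold foldSize codeLength
  omega

theorem numInstances_le (s : ℕ) :
    numInstances s ≤ codeLength s ^ 3 *
      (2 * codeLength s * (codeLength s + 2) + codeLength s + 6) := by
  have h : hashBits s ≤ 2 * codeLength s * (codeLength s + 2) + codeLength s + 6 := by
    have hs := exponent_le_codeLength s
    unfold hashBits
    rw [foldSize_eq]
    refine max_le ?_ (by omega)
    calc 2 * s * (codeLength s + 2) + s ≤
          2 * codeLength s * (codeLength s + 2) + codeLength s := by gcongr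
      _ ≤ _ := Nat.le_add_right _ _
  unfold numInstances keyLength
  calc _ = codeLength s ^ 3 * hashBits s := by ring
    _ ≤ _ := Nat.mul_le_mul_left _ h

theorem superpolynomialDecay_pow {r : ℝ} (h0 : 0 ≤ r) (h1 : r < 1) :
    Asymptotics.SuperpolynomialDecay atTop (fun n : ℕ => (n : ℝ)) fun n => r ^ n := fun d =>
  tendsto_pow_const_mul_const_pow_of_lt_one d h0 h1

end Main

/-! ### The main theorem -/

theorem mainTheorem5 :
    ∃ (P : Polynomial ℕ) (ε : ℕ → ℝ),
      Asymptotics.SuperpolynomialDecay atTop (fun n : ℕ => (n : ℝ)) ε ∧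
      ∀ (s : ℕ), 1 ≤ s →
      ∀ (γ : (CodeField s)ˣ), (∀ u : (CodeField s)ˣ, u ∈ Subgroup.zpowers γ) →
      ∀ (a : CodeField s), (a = 0 ∨ a = 1) →
      ∀ (enc : Alphabet s × Fin (codeLength s) ↪ HashField s)
        (bits : HashField s ≃ (Fin (hashBits s) → Bool)),
      ∃ Q : QSMPProtocol (AliceInput s) (BobInput s) (TBNCOutput s),
        Q.cost ≤ P.eval (codeLength s) ∧
        ∀ (HA : AliceInput s) (HB : BobInput s),
          1 - ε (codeLength s) ≤ Q.successProb (TBNC a (γ : CodeField s) enc bits) HA HB := by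
  -- A polynomial bound for the number of instances, times the factor 178n of the failure of one
  -- instance.
  let p : Polynomial ℝ := Polynomial.X ^ 3 *
    (2 * Polynomial.X * (Polynomial.X + 2) + Polynomial.X + 6) * (178 * Polynomial.X)
  refine ⟨(2 * Polynomial.X * (Polynomial.X + 2) + 6) * Polynomial.X * Polynomial.X *
    (Polynomial.X ^ 3 * (2 * Polynomial.X * (Polynomial.X + 2) + Polynomial.X + 6)),
    fun n => p.eval (n : ℝ) * (99 / 100) ^ n,
    (superpolynomialDecay_pow (by norm_num) (by norm_num)).polynomial_mul p, ?_⟩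
  intro s hs γ hγ a ha enc bits
  obtain ⟨Q, hcost, hQ⟩ := exists_TBNC_protocol hs γ hγ a ha enc bits
  have hp : p.eval (codeLength s : ℝ) = (codeLength s : ℝ) ^ 3 *
      (2 * codeLength s * (codeLength s + 2) + codeLength s + 6) * (178 * codeLength s) := by
    simp [p]
  refine ⟨Q, ?_, fun HA HB => ?_⟩
  · have hg : graphQubits s ≤ 2 * codeLength s * (codeLength s + 2) + 6 := by
      have := exponent_le_codeLength s
      unfold graphQubits
      rw [foldSize_eq]
      gcongr
    rw [hcost]
    simp only [Polynomial.eval_mul, Polynomial.eval_add, Polynomial.eval_pow, Polynomial.eval_X,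
      Polynomial.eval_ofNat]
    have := numInstances_le s
    gcongr
  · obtain ⟨h0, h2⟩ := hQ HA HB
    dsimp only
    rw [hp]
    by_cases hn : 2 ≤ codeLength s
    · refine le_trans (sub_le_sub_left ?_ 1) (h2 hn)
      have ht : (numInstances s : ℝ) ≤ (codeLength s : ℝ) ^ 3 *
          (2 * codeLength s * (codeLength s + 2) + codeLength s + 6) := by
        exact_mod_cast numInstances_le s
      calc _ = (numInstances s : ℝ) * (178 * codeLength s) * (99 / 100) ^ codeLength s := by ring
        _ ≤ _ := by gcongr
    -- For n = 1 the independence is too weak for the argument, but ε(1) exceeds 1 and the claim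
    -- reduces to nonnegativity.
    · have hn1 : codeLength s = 1 := by
        have := codeLength_pos hs
        omega
      refine le_trans ?_ h0
      rw [hn1]
      norm_num
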